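/- For a finite simple graph $G$, a set $S\subseteq V(G)$ is a connected dominating set if every vertex outside $S$ has a neighbour in $S$ and the induced subgraph $G[S]$ is connected; it is a minimal connected dominating set if moreover no proper subset of $S$ is a connected dominating set. Let $G$ be a graph on $n$ vertices that has a subgraph $G'$ with $V(G')=V(G)$ such that every vertex has degree at most $3\cdot 10^5$ in $G'$, and fewer than $\frac{1}{60}n$ vertices have degree less than $14$ in $G'$. Then $G$ has $\mathcal{O}\left(2^{n(1-10^{-26})}\right)$ minimal connected dominating sets, where the constant hidden in the $\mathcal{O}$-notation is absolute. Further, there is an algorithm (on a random access machine with logarithmic cost) that, given as input $G$ and any such $G'$, enumerates all minimal connected dominating sets of $G$, each exactly once, in time $2^{n(1-10^{-26})}\cdot n^{\mathcal{O}(1)}$. -/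

import Mathlib

/-! ### Connected dominating sets -/

/-- `S` is a connected dominating set of `G`: every vertex outside `S` has a neighbour in `S`, and
the induced subgraph `G[S]` is connected (in particular `S` is non-empty). -/
def IsConnectedDominatingSet {V : Type*} (G : SimpleGraph V) (S : Finset V) : Prop :=
  (∀ v, v ∉ S → ∃ u ∈ S, G.Adj v u) ∧ (G.induce (S : Set V)).Connected

/-- `S` is an inclusion-minimal connected dominating set of `G`. -/
def IsMinimalCDS {V : Type*} (G : SimpleGraph V) (S : Finset V) : Prop :=
  IsConnectedDominatingSet G S ∧ ∀ T : Finset V, T ⊂ S → ¬ IsConnectedDominatingSet G T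

/-- `G'` is a spanning subgraph of `G` of maximum degree at most `3 * 10 ^ 5` in which fewer than
`n / 60` vertices have degree less than `14`, where `n` is the number of vertices. -/
def IsRobustSpanningSubgraph {V : Type*} [Fintype V] (G G' : SimpleGraph V)
    [DecidableRel G'.Adj] : Prop :=
  G' ≤ G ∧ (∀ v, G'.degree v ≤ 3 * 10 ^ 5) ∧
    ((Finset.univ.filter fun v => G'.degree v < 14).card : ℝ) < (1 / 60 : ℝ) * Fintype.card V

/-! ### A random access machine with logarithmic cost

Programs are structured programs over natural-number variables and natural-number arrays; a
program is a finite syntax tree, so it mentions finitely many variables and arrays.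
Array cells are addressed indirectly. The only arithmetic is addition and truncated subtraction, and
every operation costs one unit plus the bit lengths of all the numbers it handles, addresses
included. -/
namespace RAM

/-- A memory state: variables, arrays, and the stream of numbers output so far. -/
structure State where
  var : ℕ → ℕ
  arr : ℕ → ℕ → ℕ
  out : List ℕ

/-- Expressions: constants, variables, array cells, sums and truncated differences. -/
inductive Expr where
  | const (k : ℕ)
  | var (x : ℕ)
  | arr (a : ℕ) (i : Expr)
  | add (e f : Expr)
  | sub (e f : Expr)

/-- The value of an expression. -/
def Expr.eval (s : State) : Expr → ℕ
  | .const k => k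
  | .var x => s.var x
  | .arr a i => s.arr a (i.eval s)
  | .add e f => e.eval s + f.eval s
  | .sub e f => e.eval s - f.eval s

/-- The logarithmic cost of evaluating an expression (`Nat.size` is the bit length). -/
def Expr.cost (s : State) : Expr → ℕ
  | .const k => 1 + Nat.size k
  | .var x => 1 + Nat.size (s.var x)
  | .arr a i => i.cost s + 1 + Nat.size (i.eval s) + Nat.size (s.arr a (i.eval s))
  | .add e f => e.cost s + f.cost s + 1 + Nat.size (e.eval s) + Nat.size (f.eval s)
  | .sub e f => e.cost s + f.cost s + 1 + Nat.size (e.eval s) + Nat.size (f.eval s)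

/-- Programs. -/
inductive Prog where
  | skip
  /-- `x := e` -/
  | assign (x : ℕ) (e : Expr)
  /-- `a[i] := e` -/
  | store (a : ℕ) (i e : Expr)
  /-- append the value of `e` to the output stream -/
  | output (e : Expr)
  | seq (p q : Prog)
  /-- if `e ≠ 0` then `p` else `q` -/
  | ite (e : Expr) (p q : Prog)
  /-- while `e ≠ 0` do `p` -/
  | loop (e : Expr) (p : Prog)

/-- Set the variable `x` to `v`. -/
def State.setVar (s : State) (x v : ℕ) : State :=
  { s with var := Function.update s.var x v }

/-- Set the cell `i` of the array `a` to `v`. -/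
def State.setArr (s : State) (a i v : ℕ) : State :=
  { s with arr := Function.update s.arr a (Function.update (s.arr a) i v) }

/-- Append `v` to the output stream. -/
def State.emit (s : State) (v : ℕ) : State :=
  { s with out := s.out ++ [v] }

/-- `Exec p s t s'`: started in the state `s`, the program `p` halts in the state `s'`, and the total
logarithmic cost of the run is `t`. A run that does not halt satisfies this for no `t` and `s'`. -/
inductive Exec : Prog → State → ℕ → State → Prop
  | skip (s : State) : Exec .skip s 1 s
  | assign (s : State) (x : ℕ) (e : Expr) :
      Exec (.assign x e) s (e.cost s + 1 + Nat.size (e.eval s)) (s.setVar x (e.eval s))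
  | store (s : State) (a : ℕ) (i e : Expr) :
      Exec (.store a i e) s
        (i.cost s + e.cost s + 1 + Nat.size (i.eval s) + Nat.size (e.eval s))
        (s.setArr a (i.eval s) (e.eval s))
  | output (s : State) (e : Expr) :
      Exec (.output e) s (e.cost s + 1 + Nat.size (e.eval s)) (s.emit (e.eval s))
  | seq {p q : Prog} {s s' s'' : State} {t t' : ℕ} (hp : Exec p s t s') (hq : Exec q s' t' s'') :
      Exec (.seq p q) s (t + t' + 1) s''
  | ite_true {e : Expr} {p q : Prog} {s s' : State} {t : ℕ} (he : e.eval s ≠ 0)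
      (hp : Exec p s t s') : Exec (.ite e p q) s (e.cost s + t + 1) s'
  | ite_false {e : Expr} {p q : Prog} {s s' : State} {t : ℕ} (he : e.eval s = 0)
      (hq : Exec q s t s') : Exec (.ite e p q) s (e.cost s + t + 1) s'
  | loop_true {e : Expr} {p : Prog} {s s' s'' : State} {t t' : ℕ} (he : e.eval s ≠ 0)
      (hp : Exec p s t s') (hl : Exec (.loop e p) s' t' s'') :
      Exec (.loop e p) s (e.cost s + t + t' + 1) s''
  | loop_false {e : Expr} {p : Prog} {s : State} (he : e.eval s = 0) :
      Exec (.loop e p) s (e.cost s + 1) s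

end RAM

/-! ### Input and output of the enumeration algorithm -/

open Classical in
/-- The adjacency matrix of a graph on the vertex set `{0, …, n - 1}`, row by row; cells beyond the
matrix hold `0`. -/
noncomputable def adjacencyArray {n : ℕ} (G : SimpleGraph (Fin n)) (k : ℕ) : ℕ :=
  if ∃ i j : Fin n, k = (i : ℕ) * n + (j : ℕ) ∧ G.Adj i j then 1 else 0

/-- The initial state on input `(G, G')`: variable `0` holds the number `n` of vertices, arrays `0`
and `1` hold the adjacency matrices of `G` and `G'`, everything else is `0`, and the output stream
is empty. -/
noncomputable def inputState {n : ℕ} (G G' : SimpleGraph (Fin n)) : RAM.State where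
  var x := if x = 0 then n else 0
  arr a := if a = 0 then adjacencyArray G else if a = 1 then adjacencyArray G' else fun _ => 0
  out := []

/-- The characteristic vector of a set of vertices, as a list of `n` zeros and ones. -/
def charVector {n : ℕ} (S : Finset (Fin n)) : List ℕ :=
  List.ofFn fun i => if i ∈ S then 1 else 0

/-- The output stream `out` lists the family of all minimal connected dominating sets of `G`: it is
the concatenation of their characteristic vectors, every member of the family being listed exactly
once, in some order. -/
def ListsMinimalCDS {n : ℕ} (G : SimpleGraph (Fin n)) (out : List ℕ) : Prop :=
  ∃ L : List (Finset (Fin n)), L.Nodup ∧ (∀ S, S ∈ L ↔ IsMinimalCDS G S) ∧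
    out = L.flatMap charVector

/-! Let S be a minimal connected dominating set with at least two vertices, and root G[S] at some r
in S. If a vertex v of S separates r from no other vertex, deleting v keeps S connected, so
minimality gives v a private neighbour: a vertex whose only neighbour in S is v
(`IsMinimalCDS.exists_private`). These v are the leaves of the dominator tree of G[S]. Every edge of
G[S] joins a parent and a child or two siblings of that tree, which bounds the number of vertices of
degree above two by three times the number of leaves (`card_two_lt_degree_le`). All other vertices
of S have at most two neighbours in S. Hence |S| ≤ 4σ(S), where σ(S) counts the vertices with at
most two neighbours in S; counting neighbours in G' only increases σ (`IsMinimalCDS.isSparse`).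

For a uniformly random S the mean of |S| is n/2, while the mean of σ(S) is at most n/40, since a
vertex of degree at least 14 rarely has at most two neighbours in S. So 4σ(S) − |S| has mean at most
−2n/5. One vertex changes it by at most 4·3·10^5 + 1, and an exponential moment bound
(`sum_powerset_exp_le`) shows that sets with |S| ≤ 4σ(S) are exponentially rare
(`card_isSparse_le`).

The condition |S| ≤ 4σ(S) passes to subsets, which permits pruning. The algorithm runs through the
binary codes of all sets; from a non-sparse set with lowest element l it jumps 2^l codes ahead,
skipping only supersets of that set. Every visited set becomes sparse when its lowest element is
removed, so the number of visited sets is at most n + 1 times the number of sparse ones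
(`card_isAlmostSparse_le`, `wp_enumerationStep`), and each visit has polynomial cost. -/

/-! ### Dominators in a rooted connected graph -/

namespace SimpleGraph

variable {W : Type*} {H : SimpleGraph W} {r : W}

/-- The vertices `x ≠ u` that lie on every walk from `r` to `u`. -/
def strictDominators (H : SimpleGraph W) (r u : W) : Set W :=
  {x | x ≠ u ∧ ∀ p : H.Walk r u, x ∈ p.support}

/-- The immediate dominator of `u`: a strict dominator of `u` farthest from the root `r`. -/
noncomputable def immediateDominator (H : SimpleGraph W) (r u : W) : W :=
  @Classical.epsilon W ⟨r⟩ fun v =>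
    v ∈ H.strictDominators r u ∧ ∀ w ∈ H.strictDominators r u, H.dist r w ≤ H.dist r v

/-- Prolonging a walk to v by the edge vu gives a walk to u, and x ≠ u. -/
lemma mem_support_of_adj {u v x : W} (h : H.Adj v u) (hx : x ∈ H.strictDominators r u)
    (p : H.Walk r v) : x ∈ p.support := by
  have := hx.2 (p.concat h)
  rw [Walk.support_concat] at this
  simpa [hx.1] using this

lemma dist_lt_of_forall_mem_support (hH : H.Connected) {u x : W} (hne : x ≠ u)
    (hx : ∀ p : H.Walk r u, x ∈ p.support) : H.dist r x < H.dist r u := by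
  classical
  obtain ⟨p, hp⟩ := hH.exists_walk_length_eq_dist r u
  calc H.dist r x ≤ (p.takeUntil x (hx p)).length := dist_le _
    _ < p.length := Walk.length_takeUntil_lt_length (hx p) hne
    _ = _ := hp

lemma immediateDominator_spec [Finite W] {u : W} (hu : u ≠ r) :
    H.immediateDominator r u ∈ H.strictDominators r u ∧
      ∀ w ∈ H.strictDominators r u, H.dist r w ≤ H.dist r (H.immediateDominator r u) := by
  have hne : (H.strictDominators r u).Nonempty := ⟨r, hu.symm, fun p => p.start_mem_support⟩
  obtain ⟨v, hv⟩ := Set.exists_max_image _ (H.dist r) (Set.toFinite _) hne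
  exact @Classical.epsilon_spec W
    (fun v => v ∈ H.strictDominators r u ∧ ∀ w ∈ H.strictDominators r u, H.dist r w ≤ H.dist r v)
    ⟨v, hv⟩

/-- Every strict dominator of u lies on all walks to v too, so unless it is v it is strictly closer
to the root than v. -/
lemma immediateDominator_eq_of_adj_of_mem [Finite W] (hH : H.Connected) {u v : W}
    (h : H.Adj v u) (hu : u ≠ r) (hv : v ∈ H.strictDominators r u) :
    H.immediateDominator r u = v := by
  obtain ⟨h1, h2⟩ := immediateDominator_spec (H := H) hu
  by_contra hne
  exact (h2 v hv).not_gt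
    (dist_lt_of_forall_mem_support hH hne fun p => mem_support_of_adj h h1 p)

/-- If neither end strictly dominates the other, prolonging walks by the edge shows that both have
the same strict dominators. The choice in `immediateDominator` depends on the vertex only through
that set, so uniqueness of the maximiser is not needed. -/
lemma immediateDominator_of_adj [Finite W] (hH : H.Connected) {u v : W} (h : H.Adj v u)
    (hu : u ≠ r) (hv : v ≠ r) :
    H.immediateDominator r u = v ∨ H.immediateDominator r v = u ∨
      H.immediateDominator r u = H.immediateDominator r v := by
  by_cases h1 : v ∈ H.strictDominators r u
  · exact Or.inl (immediateDominator_eq_of_adj_of_mem hH h hu h1)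
  by_cases h2 : u ∈ H.strictDominators r v
  · exact Or.inr (Or.inl (immediateDominator_eq_of_adj_of_mem hH h.symm hv h2))
  have : H.strictDominators r u = H.strictDominators r v := by
    ext x
    constructor
    · intro hx
      exact ⟨fun e => h1 (e ▸ hx), mem_support_of_adj h hx⟩
    · intro hx
      exact ⟨fun e => h2 (e ▸ hx), mem_support_of_adj h.symm hx⟩
  right; right
  simp only [immediateDominator, this]

/-- Hence a vertex without children dominates nothing. Going back along a shortest walk to u, each
vertex is still dominated by v until v itself is the penultimate one. -/
lemma exists_immediateDominator_eq [Finite W] (hH : H.Connected) {u v : W}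
    (hv : v ∈ H.strictDominators r u) : ∃ w, w ≠ r ∧ H.immediateDominator r w = v := by
  induction hd : H.dist r u using Nat.strong_induction_on generalizing u with
  | _ d ih =>
    have hur : u ≠ r := by
      rintro rfl
      exact hv.1 (by simpa using hv.2 Walk.nil)
    obtain ⟨p, hp⟩ := hH.exists_walk_length_eq_dist r u
    have hpn : ¬ p.Nil := fun hn => hur hn.eq.symm
    have hadj : H.Adj p.penultimate u := p.adj_penultimate hpn
    have hmem := mem_support_of_adj hadj hv
    by_cases hpv : p.penultimate = v
    · exact ⟨u, hur, immediateDominator_eq_of_adj_of_mem hH (hpv ▸ hadj) hur hv⟩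
    · refine ih (H.dist r p.penultimate) ?_ (u := p.penultimate) ⟨Ne.symm hpv, hmem⟩ rfl
      have h1 : H.dist r p.penultimate ≤ p.dropLast.length := dist_le _
      have h2 : p.dropLast.length + 1 = p.length := Walk.length_dropLast_add_one hpn
      omega

open Finset Classical in
/-- In a connected graph, the number of vertices of degree more than two is at most three times the
number of vertices that do not separate the root from any other vertex. -/
lemma card_two_lt_degree_le [Fintype W] [Nontrivial W] [DecidableRel H.Adj] (hH : H.Connected) (r : W) :
    (univ.filter fun v => 2 < H.degree v).card ≤
      3 * (univ.filter fun v => ∀ u, v ∉ H.strictDominators r u).card := by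
  set par := H.immediateDominator r
  set ch : W → Finset W := fun v => (univ.erase r).filter fun u => par u = v with hch
  have hcount : (univ.erase r).card = ∑ v, (ch v).card :=
    card_eq_sum_card_fiberwise fun _ _ => Finset.mem_coe.2 (mem_univ _)
  have hleaf : ∀ v, (ch v).card = 0 → ∀ u, v ∉ H.strictDominators r u := by
    intro v hv u hu
    obtain ⟨w, hw, hwv⟩ := exists_immediateDominator_eq hH hu
    rw [card_eq_zero] at hv
    have : w ∈ ch v := by simp [hch, hw, par, hwv]
    simp [hv] at this
  -- All neighbours of the root are its children. Any other vertex has only its parent, children and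
  -- siblings as neighbours, hence at most two if it has no sibling and at most one child.
  have hdeg : ∀ v, 2 < H.degree v → 2 ≤ (ch v).card ∨ (v ≠ r ∧ 2 ≤ (ch (par v)).card) := by
    intro v hv
    by_contra! hcon
    obtain ⟨hc1, hc2⟩ := hcon
    by_cases hvr : v = r
    · have hsub : H.neighborFinset v ⊆ ch v := by
        intro u hu
        have hadj : H.Adj v u := by simpa using hu
        have hur : u ≠ r := fun e => hadj.ne (hvr.trans e.symm)
        have : v ∈ H.strictDominators r u := by
          subst hvr; exact ⟨hur.symm, fun p => p.start_mem_support⟩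
        simp [hch, hur, par, immediateDominator_eq_of_adj_of_mem hH hadj hur this]
      have := card_le_card hsub
      rw [card_neighborFinset_eq_degree] at this
      omega
    · have hc2 := hc2 hvr
      have hsub : H.neighborFinset v ⊆ insert (par v) (ch v) := by
        intro u hu
        have hadj : H.Adj v u := by simpa using hu
        by_cases hur : u = r
        · have : u ∈ H.strictDominators r v := by
            subst hur; exact ⟨Ne.symm hvr, fun p => p.start_mem_support⟩
          simp [par, immediateDominator_eq_of_adj_of_mem hH hadj.symm hvr this]
        · rcases immediateDominator_of_adj hH hadj hur hvr with h | h | h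
          · simp [hch, hur, par, h]
          · simp [par, h]
          · exfalso
            have h1 : {u, v} ⊆ ch (par v) := by
              intro z hz
              simp only [mem_insert, mem_singleton] at hz
              rcases hz with rfl | rfl
              · simp [hch, hur, par, h]
              · simp [hch, hvr]
            have := card_le_card h1
            rw [card_pair hadj.ne'] at this
            omega
      have := (card_le_card hsub).trans (card_insert_le _ _)
      rw [card_neighborFinset_eq_degree] at this
      omega
  have hbound : (univ.filter fun v => 2 < H.degree v).card ≤
      ∑ v, if 2 ≤ (ch v).card then (ch v).card + 1 else 0 := by
    have hsub : (univ.filter fun v => 2 < H.degree v) ⊆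
        (univ.filter fun v => 2 ≤ (ch v).card).biUnion fun v => insert v (ch v) := by
      intro v hv
      simp only [mem_filter, mem_univ, true_and] at hv
      simp only [mem_biUnion, mem_filter, mem_univ, true_and]
      rcases hdeg v hv with h | ⟨h1, h2⟩
      · exact ⟨v, h, mem_insert_self _ _⟩
      · exact ⟨par v, h2, mem_insert_of_mem (by simp [hch, h1])⟩
    refine (card_le_card hsub).trans (card_biUnion_le.trans ?_)
    rw [sum_filter]
    refine sum_le_sum fun v _ => ?_
    split_ifs
    · exact card_insert_le _ _
    · exact le_rfl
  -- To be summed over all vertices, the numbers of children adding up to |W| − 1. Equality holds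
  -- for zero, one and two children; the case of two forces the factor 3.
  have hpt : ∀ v, (if 2 ≤ (ch v).card then (ch v).card + 1 else 0) + 3 ≤
      3 * (ch v).card + 3 * (if (ch v).card = 0 then 1 else 0) := by
    intro v
    split_ifs <;> omega
  have hsum := sum_le_sum fun v (_ : v ∈ (univ : Finset W)) => hpt v
  rw [sum_add_distrib, sum_add_distrib, ← mul_sum, ← mul_sum, ← hcount, sum_const,
    card_erase_of_mem (mem_univ r), ← card_filter] at hsum
  have hle : (univ.filter fun v => (ch v).card = 0).card ≤
      (univ.filter fun v => ∀ u, v ∉ H.strictDominators r u).card := by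
    refine card_le_card fun v hv => ?_
    simp only [mem_filter, mem_univ, true_and] at hv ⊢
    exact hleaf v hv
  have : 0 < (univ : Finset W).card := card_pos.2 ⟨r, mem_univ r⟩
  simp only [smul_eq_mul] at hsum
  omega

end SimpleGraph

/-! ### Minimal connected dominating sets and sparsely dominated vertices -/

section Dominating

variable {V : Type*} {G G' : SimpleGraph V}

open Classical in
/-- The number of neighbours of `v` in `S`. -/
noncomputable def neighborCount [Fintype V] (G : SimpleGraph V) (S : Finset V) (v : V) : ℕ :=
  (S.filter fun u => G.Adj v u).card

/-- The number of vertices with at most two neighbours in `S`. -/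
noncomputable def sparseCount [Fintype V] (G : SimpleGraph V) (S : Finset V) : ℕ :=
  (Finset.univ.filter fun v => neighborCount G S v ≤ 2).card

lemma sparseCount_anti [Fintype V] {S T : Finset V} (h : S ⊆ T) :
    sparseCount G T ≤ sparseCount G S := by
  classical
  refine Finset.card_le_card (Finset.monotone_filter_right _ fun v _ hv => ?_)
  exact (Finset.card_le_card (Finset.filter_subset_filter _ h)).trans hv

/-- The property of vertex sets, closed under taking subsets, that all minimal connected dominating
sets have and few sets have. -/
def IsSparse [Fintype V] (G : SimpleGraph V) (S : Finset V) : Prop :=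
  S.card ≤ 4 * sparseCount G S

/-- Shrinking the set lowers its size and raises `sparseCount`; the pruning of the enumeration rests
on this. -/
lemma IsSparse.anti [Fintype V] {S T : Finset V} (hT : IsSparse G T) (h : S ⊆ T) :
    IsSparse G S := by
  have := sparseCount_anti (G := G) h
  have := Finset.card_le_card h
  unfold IsSparse at *
  omega

lemma connected_induce_of_reachable {S : Finset V} {r : V} (hr : r ∈ S)
    (h : ∀ u (hu : u ∈ S), (G.induce (S : Set V)).Reachable ⟨r, hr⟩ ⟨u, hu⟩) :
    (G.induce (S : Set V)).Connected := by
  rw [SimpleGraph.connected_iff]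
  exact ⟨fun u v => (h u.1 u.2).symm.trans (h v.1 v.2), ⟨⟨r, hr⟩⟩⟩

/-- Each added vertex is dominated by S, so it is attached by an edge to a connected set. -/
lemma IsConnectedDominatingSet.mono {S T : Finset V} (hS : IsConnectedDominatingSet G S)
    (h : S ⊆ T) : IsConnectedDominatingSet G T := by
  refine ⟨fun v hv => ?_, ?_⟩
  · obtain ⟨u, hu, huv⟩ := hS.1 v fun hvS => hv (h hvS)
    exact ⟨u, h hu, huv⟩
  · obtain ⟨⟨r, hr⟩⟩ := hS.2.nonempty
    have key : ∀ u (hu : u ∈ S), (G.induce (T : Set V)).Reachable ⟨r, h hr⟩ ⟨u, h hu⟩ := by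
      intro u hu
      exact (hS.2.preconnected ⟨r, hr⟩ ⟨u, hu⟩).map
        (SimpleGraph.induceHomOfLE G (Finset.coe_subset.2 h)).toHom
    refine connected_induce_of_reachable (h hr) fun u hu => ?_
    by_cases huS : u ∈ S
    · exact key u huS
    · obtain ⟨w, hw, huw⟩ := hS.1 u huS
      refine (key w hw).trans (SimpleGraph.Adj.reachable ?_)
      simpa using huw.symm

/-- By monotonicity only single deletions have to be examined. -/
lemma isMinimalCDS_iff [DecidableEq V] {S : Finset V} :
    IsMinimalCDS G S ↔ IsConnectedDominatingSet G S ∧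
      ∀ v ∈ S, ¬ IsConnectedDominatingSet G (S.erase v) := by
  refine and_congr_right fun _ => ⟨fun h v hv => h _ (Finset.erase_ssubset hv), fun h T hT hTc => ?_⟩
  obtain ⟨v, hv, hvT⟩ := Finset.exists_of_ssubset hT
  exact h v hv (hTc.mono (Finset.subset_erase.2 ⟨hT.1, hvT⟩))

open Finset Classical in
/-- A vertex of a minimal connected dominating set that separates no vertex from the root has a
private neighbour. -/
lemma IsMinimalCDS.exists_private {S : Finset V} (hS : IsMinimalCDS G S)
    (r v : (S : Set V)) (hcard : 2 ≤ S.card)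
    (hv : ∀ u, v ∉ (G.induce (S : Set V)).strictDominators r u) :
    ∃ w, S.filter (fun u => G.Adj w u) = {v.1} := by
  obtain ⟨⟨hdom, hconn⟩, hmin⟩ := hS
  have : Nontrivial (S : Set V) := by
    obtain ⟨a, ha, b, hb, hab⟩ := one_lt_card.1 hcard
    exact ⟨⟨a, ha⟩, ⟨b, hb⟩, fun e => hab (congrArg Subtype.val e)⟩
  -- The root strictly dominates every other vertex.
  have hvr : v ≠ r := by
    rintro rfl
    obtain ⟨u, hu⟩ := exists_ne v
    exact hv u ⟨hu.symm, fun p => p.start_mem_support⟩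
  have hrS : r.1 ∈ S.erase v.1 :=
    mem_erase.2 ⟨fun e => hvr (Subtype.ext e.symm), r.2⟩
  -- Each remaining vertex is reached from r by a walk avoiding v.
  have hreach : (G.induce ((S.erase v.1 : Finset V) : Set V)).Connected := by
    refine connected_induce_of_reachable hrS fun u hu => ?_
    obtain ⟨huv, huS⟩ := mem_erase.1 hu
    have hnot := hv ⟨u, huS⟩
    simp only [SimpleGraph.strictDominators, Set.mem_ofPred_eq, not_and, not_forall] at hnot
    obtain ⟨p, hp⟩ := hnot fun e => huv (congrArg Subtype.val e).symm
    have hwalk : ∀ x ∈ (p.map (SimpleGraph.Embedding.induce (G := G) (S : Set V)).toHom).support,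
        x ∈ ((S.erase v.1 : Finset V) : Set V) := by
      intro x hx
      rw [SimpleGraph.Walk.support_map, List.mem_map] at hx
      obtain ⟨y, hy, rfl⟩ := hx
      simp only [coe_erase, Set.mem_sdiff, mem_coe, Set.mem_singleton_iff]
      exact ⟨y.2, fun e => hp ((Subtype.ext e : y = v) ▸ hy)⟩
    exact ⟨SimpleGraph.Walk.induce _ _ hwalk⟩
  -- Connectivity survives the deletion of v, so it is domination that fails.
  have hnd := hmin _ (erase_ssubset v.2)
  have hnd : ¬ ∀ w, w ∉ S.erase v.1 → ∃ u ∈ S.erase v.1, G.Adj w u := fun h => hnd ⟨h, hreach⟩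
  push Not at hnd
  obtain ⟨w, hw, hwn⟩ := hnd
  -- The undominated vertex is not v, which has a neighbour in the connected set S.
  have hwS : w ∉ S := by
    intro hwS
    have hwv : w = v.1 := by
      by_contra hne
      exact hw (mem_erase.2 ⟨hne, hwS⟩)
    obtain ⟨u, hu⟩ := hconn.preconnected.exists_adj_of_nontrivial v
    have hadj : G.Adj v.1 u.1 := by simpa using hu
    exact hwn u.1 (mem_erase.2 ⟨hadj.ne', u.2⟩) (hwv ▸ hadj)
  obtain ⟨u, huS, huw⟩ := hdom w hwS
  have key : ∀ z ∈ S, G.Adj w z → z = v.1 := by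
    intro z hz hwz
    by_contra hne
    exact hwn z (mem_erase.2 ⟨hne, hz⟩) hwz
  refine ⟨w, ?_⟩
  ext z
  simp only [mem_filter, mem_singleton]
  constructor
  · exact fun h => key z h.1 h.2
  · rintro rfl
    exact ⟨v.2, key u huS huw ▸ huw⟩

-- Distinct leaves have distinct private neighbours, so there are at most `sparseCount` leaves and
-- at most three times as many vertices of degree above two. The remaining vertices of S are
-- sparsely dominated themselves.
open Finset Classical in
lemma IsMinimalCDS.isSparse [Fintype V] (h : G' ≤ G) {S : Finset V} (hS : IsMinimalCDS G S) :
    IsSparse G' S := by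
  have hmono : ∀ v, neighborCount G' S v ≤ (S.filter fun u => G.Adj v u).card := fun v =>
    card_le_card (monotone_filter_right _ fun u _ hu => h hu)
  rcases Nat.lt_or_ge S.card 2 with hlt | hcard
  · have : sparseCount G' S = Fintype.card V := by
      rw [sparseCount, filter_true_of_mem, card_univ]
      intro v _
      exact (card_filter_le _ _).trans (by omega)
    have := card_le_univ S
    unfold IsSparse
    omega
  obtain ⟨r⟩ := hS.1.2.nonempty
  have : Nontrivial (S : Set V) := by
    obtain ⟨a, ha, b, hb, hab⟩ := one_lt_card.1 hcard
    exact ⟨⟨a, ha⟩, ⟨b, hb⟩, fun e => hab (congrArg Subtype.val e)⟩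
  have hD := SimpleGraph.card_two_lt_degree_le hS.1.2 r
  have hL : (univ.filter fun v => ∀ u, v ∉ (G.induce (S : Set V)).strictDominators r u).card ≤
      sparseCount G' S := by
    have hex : ∀ v : (S : Set V), ∃ w, (∀ u, v ∉ (G.induce (S : Set V)).strictDominators r u) →
        S.filter (fun u => G.Adj w u) = {v.1} := by
      intro v
      by_cases hv : ∀ u, v ∉ (G.induce (S : Set V)).strictDominators r u
      · obtain ⟨w, hw⟩ := hS.exists_private r v hcard hv
        exact ⟨w, fun _ => hw⟩
      · exact ⟨r, fun hv' => absurd hv' hv⟩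
    choose p hp using hex
    refine card_le_card_of_injOn p (fun v hv => ?_) fun v hv v' hv' e => ?_
    · simp only [coe_filter, mem_univ, true_and, Set.mem_ofPred_eq] at hv ⊢
      have := hmono (p v)
      rw [hp v hv, card_singleton] at this
      omega
    · simp only [coe_filter, mem_univ, true_and, Set.mem_ofPred_eq] at hv hv'
      have h1 := hp v hv
      rw [e, hp v' hv'] at h1
      exact Subtype.ext (singleton_injective h1).symm
  have hlow : (univ.filter fun v => ¬ 2 < (G.induce (S : Set V)).degree v).card ≤
      sparseCount G' S := by
    refine card_le_card_of_injOn Subtype.val (fun v hv => ?_) Subtype.val_injective.injOn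
    simp only [coe_filter, mem_univ, true_and, Set.mem_ofPred_eq, not_lt] at hv ⊢
    refine (hmono v).trans (le_trans ?_ hv)
    rw [← SimpleGraph.card_neighborFinset_eq_degree]
    refine (card_le_card (t := ((G.induce (S : Set V)).neighborFinset v).map
      (Function.Embedding.subtype _)) fun u hu => ?_).trans (card_map _).le
    simp only [mem_filter] at hu
    simp only [mem_map, SimpleGraph.mem_neighborFinset, Function.Embedding.subtype_apply]
    exact ⟨⟨u, hu.1⟩, by simpa using hu.2, rfl⟩
  have hsplit := card_filter_add_card_filter_not (s := (univ : Finset (S : Set V)))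
    (fun v => 2 < (G.induce (S : Set V)).degree v)
  have hSc : (univ : Finset (S : Set V)).card = S.card := by
    simp
  unfold IsSparse
  omega

end Dominating

/-! ### Exponential moments of functions with bounded differences on a power set -/

section Concentration

open Finset

/-- **McDiarmid's inequality** on the uniform power set: a function with differences bounded by `c`
has a subgaussian moment generating function. -/
lemma sum_powerset_exp_le {α : Type*} [DecidableEq α] (U : Finset α) (c : ℝ) (f : Finset α → ℝ)
    (hf : ∀ S a, |f (insert a S) - f S| ≤ c) :
    ∑ S ∈ U.powerset, Real.exp (f S) ≤
      2 ^ U.card * Real.exp ((∑ S ∈ U.powerset, f S) / 2 ^ U.card + U.card * (c ^ 2 / 8)) := by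
  induction U using Finset.induction_on generalizing f with
  | empty => simp
  | insert a U ha ih =>
    rw [sum_powerset_insert ha, sum_powerset_insert ha, card_insert_of_notMem ha]
    -- The difference bound is assumed for all sets, so f and S ↦ f (S ∪ {a}) both satisfy it. Their
    -- means differ by at most c, and averaging the two exponentials costs a factor cosh d ≤ exp
    -- (d²/2) with |d| ≤ c/2.
    have h0 := ih f hf
    have h1 := ih (fun S => f (insert a S)) fun S b => by
      rw [Finset.insert_comm]; exact hf _ _
    set N : ℝ := 2 ^ U.card with hN
    have hNpos : 0 < N := by positivity
    set A := (∑ S ∈ U.powerset, f S) with hA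
    set B := (∑ S ∈ U.powerset, f (insert a S)) with hB
    have hAB : |B - A| ≤ N * c := by
      rw [hA, hB, ← sum_sub_distrib]
      refine (abs_sum_le_sum_abs _ _).trans ((sum_le_sum fun S _ => hf S a).trans ?_)
      rw [sum_const, card_powerset, nsmul_eq_mul, hN]
      push_cast
      exact le_rfl
    set m := (A / N + B / N) / 2
    set d := (B / N - A / N) / 2
    set q := (U.card : ℝ) * (c ^ 2 / 8)
    have hd : d ^ 2 / 2 ≤ c ^ 2 / 8 := by
      have : |B / N - A / N| ≤ c := by
        rw [← sub_div, abs_div, abs_of_pos hNpos, div_le_iff₀ hNpos]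
        linarith
      have := sq_le_sq' (abs_le.1 this).1 (abs_le.1 this).2
      simp only [d]
      linarith
    calc _ ≤ N * Real.exp (A / N + q) + N * Real.exp (B / N + q) := add_le_add h0 h1
      _ = 2 * N * Real.exp (m + q) * Real.cosh d := by
        rw [Real.cosh_eq, show A / N + q = (m + q) + -d by simp only [m, d]; ring,
          show B / N + q = (m + q) + d by simp only [m, d]; ring, Real.exp_add, Real.exp_add _ d]
        ring
      _ ≤ 2 * N * Real.exp (m + q) * Real.exp (c ^ 2 / 8) := by
        gcongr
        exact (Real.cosh_le_exp_half_sq d).trans (Real.exp_le_exp.2 hd)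
      _ = _ := by
        rw [mul_assoc, ← Real.exp_add, show (2 : ℝ) ^ (U.card + 1) = 2 * N by rw [hN]; ring]
        congr 2
        push_cast
        simp only [m, q]
        field_simp
        ring

lemma sum_powerset_card {α : Type*} [DecidableEq α] (U : Finset α) :
    (∑ S ∈ U.powerset, (S.card : ℝ)) = U.card * 2 ^ U.card / 2 := by
  induction U using Finset.induction_on with
  | empty => simp
  | insert a U ha ih =>
    rw [sum_powerset_insert ha, ih, card_insert_of_notMem ha,
      sum_congr rfl fun S hS => by
        rw [card_insert_of_notMem fun h => ha (mem_powerset.1 hS h), Nat.cast_succ],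
      sum_add_distrib, ih]
    simp only [sum_const, card_powerset, nsmul_eq_mul]
    push_cast
    ring

lemma card_filter_card_le_two {α : Type*} [DecidableEq α] (A : Finset α) :
    2 * (A.powerset.filter fun S => S.card ≤ 2).card = A.card ^ 2 + A.card + 2 := by
  have h : A.powerset.filter (fun S => S.card ≤ 2) =
      (range 3).biUnion fun k => powersetCard k A := by
    ext S
    simp only [mem_filter, mem_powerset, mem_biUnion, mem_range, mem_powersetCard]
    constructor
    · exact fun h => ⟨S.card, by omega, h.1, rfl⟩
    · rintro ⟨k, hk, h1, h2⟩
      exact ⟨h1, by omega⟩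
  rw [h, card_biUnion]
  · simp only [card_powersetCard, sum_range_succ, sum_range_zero, Nat.choose_zero_right,
      Nat.choose_one_right, Nat.choose_two_right]
    have := Nat.div_mul_cancel (even_iff_two_dvd.1 (Nat.even_mul_pred_self A.card))
    rcases Nat.eq_zero_or_pos A.card with h0 | h0
    · simp [h0]
    · obtain ⟨k, hk⟩ := Nat.exists_eq_succ_of_ne_zero h0.ne'
      rw [hk] at this ⊢
      simp only [Nat.succ_eq_add_one, Nat.add_sub_cancel] at this ⊢
      nlinarith
  · exact fun i _ j _ hij => pairwise_disjoint_powersetCard A hij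

/-- The subsets of `U` meeting `A ⊆ U` in at most two points. -/
lemma card_filter_inter_le_two {α : Type*} [DecidableEq α] {U A : Finset α} (hA : A ⊆ U) :
    (U.powerset.filter fun S => (S ∩ A).card ≤ 2).card * 2 ^ A.card =
      (A.powerset.filter fun S => S.card ≤ 2).card * 2 ^ U.card := by
  have hcard : (U.powerset.filter fun S => (S ∩ A).card ≤ 2).card =
      ((A.powerset.filter fun S => S.card ≤ 2) ×ˢ (U \ A).powerset).card := by
    refine card_bij' (fun S _ => (S ∩ A, S \ A)) (fun p _ => p.1 ∪ p.2) ?_ ?_ ?_ ?_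
    · intro S hS
      simp only [mem_filter, mem_powerset, mem_product] at hS ⊢
      exact ⟨⟨inter_subset_right, hS.2⟩, sdiff_subset_sdiff hS.1 le_rfl⟩
    · rintro ⟨P, Q⟩ h
      simp only [mem_filter, mem_powerset, mem_product, subset_sdiff] at h ⊢
      obtain ⟨⟨h1, h2⟩, h3, h4⟩ := h
      refine ⟨union_subset (h1.trans hA) h3, ?_⟩
      rwa [union_inter_distrib_right, disjoint_iff_inter_eq_empty.1 h4, union_empty,
        inter_eq_left.2 h1]
    · intro S _
      simp only
      rw [union_comm, sdiff_union_inter]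
    · rintro ⟨P, Q⟩ h
      simp only [mem_filter, mem_powerset, mem_product, subset_sdiff] at h
      obtain ⟨⟨h1, h2⟩, h3, h4⟩ := h
      refine Prod.ext ?_ ?_
      · simp only
        rw [union_inter_distrib_right, disjoint_iff_inter_eq_empty.1 h4, union_empty,
          inter_eq_left.2 h1]
      · simp only
        rw [union_sdiff_distrib, sdiff_eq_empty_iff_subset.2 h1, empty_union,
          sdiff_eq_self_of_disjoint h4]
  rw [hcard, card_product, card_powerset, card_sdiff_of_subset hA, mul_assoc, ← pow_add,
    Nat.sub_add_cancel (card_le_card hA)]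

end Concentration

/-! ### Few sets are sparse -/

section Counting

open Finset Classical

variable {V : Type*} [Fintype V] {G : SimpleGraph V}

/-- Only neighbours of a can cease to be sparsely dominated when a joins S. -/
lemma sparseCount_le_insert [DecidableRel G.Adj] (S : Finset V) (a : V) :
    sparseCount G S ≤ sparseCount G (insert a S) + G.degree a := by
  rw [← SimpleGraph.card_neighborFinset_eq_degree]
  refine le_trans (card_le_card fun v hv => ?_) (card_union_le _ _)
  by_cases hva : G.Adj v a
  · exact mem_union_right _ (by simpa using hva.symm)
  · refine mem_union_left _ ?_
    rw [mem_filter] at hv ⊢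
    refine ⟨hv.1, ?_⟩
    rw [neighborCount, filter_insert, if_neg hva]
    exact hv.2

lemma card_inter_le_neighborCount {v : V} {S A : Finset V} (h : ∀ u ∈ A, G.Adj v u) :
    (S ∩ A).card ≤ neighborCount G S v := by
  refine card_le_card fun u hu => ?_
  rw [mem_inter] at hu
  exact mem_filter.2 ⟨hu.1, h u hu.2⟩

/-- Among the 2^14 subsets of 14 chosen neighbours, 1 + 14 + 91 = 106 have at most two elements. -/
lemma card_neighborCount_le_two [DecidableRel G.Adj] {v : V} (hv : 14 ≤ G.degree v) :
    ((univ.filter fun S : Finset V => neighborCount G S v ≤ 2).card : ℝ) ≤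
      106 / 16384 * 2 ^ Fintype.card V := by
  rw [← SimpleGraph.card_neighborFinset_eq_degree] at hv
  obtain ⟨A, hA, hAc⟩ := exists_subset_card_eq hv
  have h1 := card_filter_inter_le_two (subset_univ A)
  have h2 := card_filter_card_le_two A
  rw [hAc] at h1 h2
  rw [show (A.powerset.filter fun S => S.card ≤ 2).card = 106 by omega, card_univ] at h1
  have h3 : (univ.filter fun S : Finset V => neighborCount G S v ≤ 2).card ≤
      ((univ : Finset V).powerset.filter fun S => (S ∩ A).card ≤ 2).card := by
    refine card_le_card fun S hS => ?_
    simp only [mem_filter, mem_univ, true_and, powerset_univ] at hS ⊢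
    exact (card_inter_le_neighborCount fun u hu => by simpa using hA hu).trans hS
  have h4 : (((univ : Finset V).powerset.filter fun S => (S ∩ A).card ≤ 2).card : ℝ) * 2 ^ 14 =
      106 * 2 ^ Fintype.card V := by exact_mod_cast h1
  have h5 : ((univ.filter fun S : Finset V => neighborCount G S v ≤ 2).card : ℝ) ≤
      (((univ : Finset V).powerset.filter fun S => (S ∩ A).card ≤ 2).card : ℝ) := by
    exact_mod_cast h3
  linarith

/-- Linearity of expectation, with probability 1 allowed for vertices of small degree; 1/60 +
106/16384 < 1/40. -/
lemma sum_sparseCount_le [DecidableRel G.Adj]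
    (hlow : ((univ.filter fun v => G.degree v < 14).card : ℝ) < (1 / 60 : ℝ) * Fintype.card V) :
    ∑ S : Finset V, (sparseCount G S : ℝ) ≤ 1 / 40 * Fintype.card V * 2 ^ Fintype.card V := by
  have hswap : ∑ S : Finset V, (sparseCount G S : ℝ) =
      ∑ v, ((univ.filter fun S : Finset V => neighborCount G S v ≤ 2).card : ℝ) := by
    simp only [sparseCount, card_filter, Nat.cast_sum]
    rw [sum_comm]
  have hpt : ∀ v, ((univ.filter fun S : Finset V => neighborCount G S v ≤ 2).card : ℝ) ≤
      (if G.degree v < 14 then 2 ^ Fintype.card V else 0) +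
        106 / 16384 * 2 ^ Fintype.card V := by
    intro v
    split_ifs with hv
    · have : (univ.filter fun S : Finset V => neighborCount G S v ≤ 2).card ≤
          2 ^ Fintype.card V := by
        rw [← Fintype.card_finset]
        exact card_le_univ _
      have : ((univ.filter fun S : Finset V => neighborCount G S v ≤ 2).card : ℝ) ≤
          2 ^ Fintype.card V := by exact_mod_cast this
      have : (0 : ℝ) ≤ 106 / 16384 * 2 ^ Fintype.card V := by positivity
      linarith
    · rw [zero_add]
      exact card_neighborCount_le_two (not_lt.1 hv)
  rw [hswap]
  refine (sum_le_sum fun v _ => hpt v).trans ?_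
  rw [sum_add_distrib, ← sum_filter, sum_const, sum_const, card_univ, nsmul_eq_mul, nsmul_eq_mul]
  have hpos : (0 : ℝ) < 2 ^ Fintype.card V := by positivity
  have := mul_le_mul_of_nonneg_right hlow.le hpos.le
  have hn : (0 : ℝ) ≤ Fintype.card V * 2 ^ Fintype.card V := by positivity
  nlinarith

/-- In a graph of bounded degree in which few vertices have small degree, few sets are sparse. -/
theorem card_isSparse_le [DecidableRel G.Adj] (hdeg : ∀ v, G.degree v ≤ 3 * 10 ^ 5)
    (hlow : ((univ.filter fun v => G.degree v < 14).card : ℝ) < (1 / 60 : ℝ) * Fintype.card V) :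
    ((univ.filter fun S : Finset V => IsSparse G S).card : ℝ) ≤
      (2 : ℝ) ^ ((Fintype.card V : ℝ) * (1 - 1 / 10 ^ 26)) := by
  set n := Fintype.card V with hn
  -- 4·3·10^5 + 1 bounds the change of 4 `sparseCount` − |S| caused by one vertex.
  set c : ℝ := 1200001 with hc
  set f : Finset V → ℝ := fun S => 1 / c ^ 2 * (4 * sparseCount G S - S.card) with hf
  have hdiff : ∀ S a, |f (insert a S) - f S| ≤ 1 / c := by
    intro S a
    have h1 : (sparseCount G (insert a S) : ℝ) ≤ sparseCount G S := by
      exact_mod_cast sparseCount_anti (subset_insert a S)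
    have h2 : (sparseCount G S : ℝ) ≤ sparseCount G (insert a S) + 3 * 10 ^ 5 := by
      have := (sparseCount_le_insert S a).trans (Nat.add_le_add_left (hdeg a) _)
      exact_mod_cast this
    have h3 : (S.card : ℝ) ≤ (insert a S).card := by
      exact_mod_cast card_le_card (subset_insert a S)
    have h4 : ((insert a S).card : ℝ) ≤ S.card + 1 := by exact_mod_cast card_insert_le a S
    rw [hf]
    simp only
    rw [← mul_sub, abs_mul, abs_of_pos (by positivity), div_mul_eq_mul_div, one_mul,
      div_le_div_iff₀ (by positivity) (by positivity)]
    have : |4 * (sparseCount G (insert a S) : ℝ) - (insert a S).card -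
        (4 * sparseCount G S - S.card)| ≤ c := by
      rw [abs_le]
      constructor <;> linarith
    nlinarith
  have hmain := sum_powerset_exp_le (univ : Finset V) (1 / c) f hdiff
  have hsum : ∑ S ∈ (univ : Finset V).powerset, f S ≤ 1 / c ^ 2 * (-(2 / 5) * n * 2 ^ n) := by
    rw [hf, ← mul_sum, sum_sub_distrib, sum_powerset_card, ← mul_sum, powerset_univ, card_univ]
    have := sum_sparseCount_le hlow
    gcongr
    linarith
  rw [card_univ, ← hn, powerset_univ] at hmain
  rw [powerset_univ] at hsum
  -- The left side is at most (−2/5 + 1/8) n/c², about −2·10^(−13) n, so 10^(−26) leaves ample room.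
  have hexp : (∑ S, f S) / 2 ^ n + n * ((1 / c) ^ 2 / 8) ≤ -(Real.log 2 * (n / 10 ^ 26)) := by
    have h1 : (∑ S, f S) / 2 ^ n ≤ 1 / c ^ 2 * (-(2 / 5) * n) := by
      rw [div_le_iff₀ (by positivity)]
      linarith
    have h2 : Real.log 2 ≤ 1 := by linarith [Real.log_two_lt_d9]
    have h3 : Real.log 2 * ((n : ℝ) / 10 ^ 26) ≤ 1 * ((n : ℝ) / 10 ^ 26) := by gcongr
    have h4 : (0 : ℝ) ≤ n := Nat.cast_nonneg n
    rw [hc] at *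
    norm_num at *
    linarith
  calc ((univ.filter fun S : Finset V => IsSparse G S).card : ℝ)
      = ∑ S ∈ univ.filter fun S : Finset V => IsSparse G S, (1 : ℝ) := by simp
    -- Markov's inequality: f is non-negative on sparse sets.
    _ ≤ ∑ S ∈ univ.filter fun S : Finset V => IsSparse G S, Real.exp (f S) := by
        refine sum_le_sum fun S hS => Real.one_le_exp ?_
        have h : S.card ≤ 4 * sparseCount G S := (mem_filter.1 hS).2
        have : (S.card : ℝ) ≤ 4 * sparseCount G S := by exact_mod_cast h
        exact mul_nonneg (by positivity) (by linarith)
    _ ≤ ∑ S, Real.exp (f S) :=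
        sum_le_sum_of_subset_of_nonneg (subset_univ _) fun _ _ _ => (Real.exp_pos _).le
    _ ≤ 2 ^ n * Real.exp (-(Real.log 2 * (n / 10 ^ 26))) := by
        refine hmain.trans ?_
        gcongr
    _ = (2 : ℝ) ^ ((n : ℝ) * (1 - 1 / 10 ^ 26)) := by
        rw [mul_sub, Real.rpow_sub two_pos, mul_one, Real.rpow_natCast,
          Real.rpow_def_of_pos two_pos, Real.exp_neg, ← div_eq_mul_inv, mul_one_div]

end Counting

/-! ### Weakest preconditions with running times for the random access machine -/

namespace RAM

/-- All numbers in the memory are at most `M`. -/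
def State.Bounded (M : ℕ) (s : State) : Prop :=
  (∀ x, s.var x ≤ M) ∧ ∀ a i, s.arr a i ≤ M

/-- The value of `e` is at most `e.weight * (M + 1)` if the memory is bounded by `M`. -/
def Expr.weight : Expr → ℕ
  | .const k => k
  | .var _ => 1
  | .arr _ _ => 1
  | .add e f => e.weight + f.weight
  | .sub e f => e.weight + f.weight

/-- The cost of `e` is at most `e.steps * (M + 1)` if the memory is bounded by `M`. -/
def Expr.steps : Expr → ℕ
  | .const k => 1 + k
  | .var _ => 1
  | .arr _ i => i.steps + i.weight + 1
  | .add e f => e.steps + f.steps + e.weight + f.weight + 1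
  | .sub e f => e.steps + f.steps + e.weight + f.weight + 1

/-- A wasteful bound on bit lengths, but the memory only holds numbers polynomial in n, so the loss
is a polynomial factor. -/
lemma size_le_self (k : ℕ) : Nat.size k ≤ k := Nat.size_le.2 Nat.lt_two_pow_self

variable {M : ℕ} {s : State}

lemma Expr.eval_le (hs : s.Bounded M) (e : Expr) : e.eval s ≤ e.weight * (M + 1) := by
  induction e with
  | const k => exact Nat.le_mul_of_pos_right _ (Nat.succ_pos M)
  | var x => simp only [Expr.eval, Expr.weight]; have := hs.1 x; omega
  | arr a i => simp only [Expr.eval, Expr.weight]; have := hs.2 a (i.eval s); omega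
  | add e f he hf => simp only [Expr.eval, Expr.weight, Nat.add_mul]; omega
  | sub e f he hf => simp only [Expr.eval, Expr.weight, Nat.add_mul]; omega

lemma Expr.size_eval_le (hs : s.Bounded M) (e : Expr) :
    Nat.size (e.eval s) ≤ e.weight * (M + 1) :=
  (size_le_self _).trans (e.eval_le hs)

lemma Expr.cost_le (hs : s.Bounded M) (e : Expr) : e.cost s ≤ e.steps * (M + 1) := by
  induction e with
  | const k =>
    refine le_trans ?_ (Nat.le_mul_of_pos_right _ (Nat.succ_pos M))
    exact Nat.add_le_add_left (size_le_self k) 1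
  | var x =>
    simp only [Expr.cost, Expr.steps]
    have := (size_le_self _).trans (hs.1 x)
    omega
  | arr a i hi =>
    simp only [Expr.cost, Expr.steps, Nat.add_mul]
    have := (size_le_self _).trans (hs.2 a (i.eval s))
    have := i.size_eval_le hs
    omega
  | add e f he hf =>
    simp only [Expr.cost, Expr.steps, Nat.add_mul]
    have := e.size_eval_le hs
    have := f.size_eval_le hs
    omega
  | sub e f he hf =>
    simp only [Expr.cost, Expr.steps, Nat.add_mul]
    have := e.size_eval_le hs
    have := f.size_eval_le hs
    omega

@[simp] lemma setVar_var (s : State) (x v y : ℕ) :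
    (s.setVar x v).var y = if y = x then v else s.var y := by
  simp [State.setVar, Function.update_apply]

@[simp] lemma setVar_arr (s : State) (x v : ℕ) : (s.setVar x v).arr = s.arr := rfl

@[simp] lemma setVar_out (s : State) (x v : ℕ) : (s.setVar x v).out = s.out := rfl

@[simp] lemma setArr_arr (s : State) (a i v b k : ℕ) :
    (s.setArr a i v).arr b k = if b = a ∧ k = i then v else s.arr b k := by
  by_cases hb : b = a
  · subst hb; simp [State.setArr, Function.update_apply]
  · simp [State.setArr, hb]

lemma setArr_arr_of_ne (s : State) {a b : ℕ} (i v : ℕ) (h : b ≠ a) :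
    (s.setArr a i v).arr b = s.arr b := by
  simp [State.setArr, h]

@[simp] lemma setArr_var (s : State) (a i v : ℕ) : (s.setArr a i v).var = s.var := rfl

@[simp] lemma setArr_out (s : State) (a i v : ℕ) : (s.setArr a i v).out = s.out := rfl

lemma State.Bounded.setVar (hs : s.Bounded M) {v : ℕ} (hv : v ≤ M) (x : ℕ) :
    (s.setVar x v).Bounded M := by
  refine ⟨fun y => ?_, hs.2⟩
  rw [setVar_var]
  split_ifs
  exacts [hv, hs.1 y]

lemma State.Bounded.setArr (hs : s.Bounded M) {v : ℕ} (hv : v ≤ M) (a i : ℕ) :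
    (s.setArr a i v).Bounded M := by
  refine ⟨hs.1, fun b k => ?_⟩
  rw [setArr_arr]
  split_ifs
  exacts [hv, hs.2 b k]

/-- Started in `s` with memory bounded by `M`, the program `p` halts within cost `k * (M + 1)`, with
memory still bounded by `M`, in a state satisfying `Q`. -/
def WP (M : ℕ) (p : Prog) (k : ℕ) (Q : State → Prop) (s : State) : Prop :=
  s.Bounded M → ∃ t s', Exec p s t s' ∧ t ≤ k * (M + 1) ∧ s'.Bounded M ∧ Q s'

variable {p q : Prog} {k k' kb : ℕ} {Q Q' : State → Prop} {e : Expr}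

lemma WP.mono (h : WP M p k Q s) (hQ : ∀ s', Q s' → Q' s') (hk : k ≤ k') : WP M p k' Q' s := by
  intro hs
  obtain ⟨t, s', h1, h2, h3, h4⟩ := h hs
  exact ⟨t, s', h1, h2.trans (Nat.mul_le_mul_right _ hk), h3, hQ _ h4⟩

lemma WP.imp (h : WP M p k Q s) (hQ : ∀ s', Q s' → Q' s') : WP M p k Q' s := h.mono hQ le_rfl

lemma WP.skip (h : Q s) : WP M .skip 1 Q s := fun hs => ⟨1, s, .skip s, by omega, hs, h⟩

lemma WP.assign {x : ℕ} (hv : e.eval s ≤ M) (h : Q (s.setVar x (e.eval s))) :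
    WP M (.assign x e) (e.steps + e.weight + 1) Q s := by
  intro hs
  refine ⟨_, _, .assign s x e, ?_, hs.setVar hv x, h⟩
  have := e.cost_le hs
  have := e.size_eval_le hs
  simp only [Nat.add_mul]
  omega

lemma WP.store {a : ℕ} {i : Expr} (hv : e.eval s ≤ M) (h : Q (s.setArr a (i.eval s) (e.eval s))) :
    WP M (.store a i e) (i.steps + e.steps + i.weight + e.weight + 1) Q s := by
  intro hs
  refine ⟨_, _, .store s a i e, ?_, hs.setArr hv a _, h⟩
  have := e.cost_le hs
  have := e.size_eval_le hs
  have := i.cost_le hs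
  have := i.size_eval_le hs
  simp only [Nat.add_mul]
  omega

/-- The output stream is not part of the bounded memory, so the emitted value needs no bound. -/
lemma WP.output (h : Q (s.emit (e.eval s))) :
    WP M (.output e) (e.steps + e.weight + 1) Q s := by
  intro hs
  refine ⟨_, _, .output s e, ?_, hs, h⟩
  have := e.cost_le hs
  have := e.size_eval_le hs
  simp only [Nat.add_mul]
  omega

lemma WP.seq (h : WP M p k (WP M q k' Q) s) : WP M (.seq p q) (k + k' + 1) Q s := by
  intro hs
  obtain ⟨t, s', h1, h2, h3, h4⟩ := h hs
  obtain ⟨t', s'', h5, h6, h7, h8⟩ := h4 h3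
  refine ⟨_, _, .seq h1 h5, ?_, h7, h8⟩
  simp only [Nat.add_mul]
  omega

lemma WP.ite (ht : e.eval s ≠ 0 → WP M p k Q s) (hf : e.eval s = 0 → WP M q k' Q s) :
    WP M (.ite e p q) (e.steps + k + k' + 1) Q s := by
  intro hs
  have := e.cost_le hs
  by_cases he : e.eval s = 0
  · obtain ⟨t, s', h1, h2, h3, h4⟩ := hf he hs
    refine ⟨_, _, .ite_false he h1, ?_, h3, h4⟩
    simp only [Nat.add_mul]
    omega
  · obtain ⟨t, s', h1, h2, h3, h4⟩ := ht he hs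
    refine ⟨_, _, .ite_true he h1, ?_, h3, h4⟩
    simp only [Nat.add_mul]
    omega

/-- The parameter m is a strictly decreasing variant, so it bounds the number of iterations. -/
lemma WP.loop (I : ℕ → State → Prop)
    (hstep : ∀ m s, s.Bounded M → I m s → e.eval s ≠ 0 →
      WP M p kb (fun s' => ∃ m' < m, I m' s') s)
    (hQ : ∀ m s, I m s → e.eval s = 0 → Q s) (m : ℕ) (h : I m s) :
    WP M (.loop e p) (m * (kb + e.steps + 1) + e.steps + 1) Q s := by
  induction m using Nat.strong_induction_on generalizing s with
  | _ m ih =>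
    intro hs
    have hcost := e.cost_le hs
    by_cases he : e.eval s = 0
    · refine ⟨_, _, .loop_false he, ?_, hs, hQ m s h he⟩
      simp only [Nat.add_mul]
      omega
    · obtain ⟨t, s', h1, h2, h3, m', hm', h4⟩ := hstep m s hs h he hs
      obtain ⟨t', s'', h5, h6, h7, h8⟩ := ih m' hm' h4 h3
      refine ⟨_, _, .loop_true he h1 h5, ?_, h7, h8⟩
      have hle : m' * (kb + e.steps + 1) + e.steps + 1 + (kb + e.steps + 1) ≤
          m * (kb + e.steps + 1) + e.steps + 1 := by
        have := Nat.mul_le_mul_right (kb + e.steps + 1) (Nat.succ_le_of_lt hm')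
        rw [Nat.succ_mul] at this
        omega
      refine le_trans ?_ (Nat.mul_le_mul_right _ hle)
      rw [Nat.add_mul _ (kb + e.steps + 1)]
      have : (kb + e.steps + 1) * (M + 1) = kb * (M + 1) + e.steps * (M + 1) + (M + 1) := by ring
      omega

/-- `for i := 0, …, n - 1 do body`, where `n` is the value of the variable `0`. -/
def forN (i : ℕ) (body : Prog) : Prog :=
  .seq (.assign i (.const 0))
    (.loop (.sub (.var 0) (.var i)) (.seq body (.assign i (.add (.var i) (.const 1)))))

lemma WP.forN {i n : ℕ} {body : Prog} (I : ℕ → State → Prop) (hM : n ≤ M)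
    (hvar : ∀ k s, I k s → s.var 0 = n) (h0 : I 0 (s.setVar i 0))
    (hstep : ∀ k < n, ∀ s, s.Bounded M → I k s → s.var i = k →
      WP M body kb (fun s' => s'.var i = k ∧ I (k + 1) (s'.setVar i (k + 1))) s)
    (hQ : ∀ s, I n s → Q s) : WP M (forN i body) (n * (kb + 16) + 9) Q s := by
  refine WP.mono (k := 2 + (n * (kb + 10 + 5 + 1) + 5 + 1) + 1) ?_ (fun _ h => h)
    (by simp only [Nat.mul_add]; omega)
  refine WP.seq (WP.assign (Nat.zero_le _) ?_)
  refine WP.loop (kb := kb + 10) (e := .sub (.var 0) (.var i))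
    (fun m s => ∃ k, k + m = n ∧ s.var i = k ∧ I k s) ?_ ?_ n
    ⟨0, by simp, by simp [Expr.eval], by simpa [Expr.eval] using h0⟩
  · rintro m s hs ⟨k, hk, hi, hI⟩ he
    simp only [Expr.eval, hvar k s hI, hi] at he
    refine WP.mono (k := kb + 9 + 1) (WP.seq ?_) (fun _ h => h) le_rfl
    refine (hstep k (by omega) s hs hI hi).imp fun s' hs' => ?_
    refine WP.assign ?_ ?_
    · simp only [Expr.eval, hs'.1]; omega
    · refine ⟨m - 1, by omega, k + 1, by omega, ?_, ?_⟩
      · simp [Expr.eval, hs'.1]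
      · simpa [Expr.eval, hs'.1] using hs'.2
  · rintro m s ⟨k, hk, hi, hI⟩ he
    simp only [Expr.eval, hvar k s hI, hi] at he
    obtain rfl : k = n := by omega
    exact hQ s hI

/-- The states `s` and `s'` agree, except for the variables in `X` and the arrays in `A`. -/
def Frame (X A : List ℕ) (s s' : State) : Prop :=
  (∀ x, x ∉ X → s'.var x = s.var x) ∧ (∀ a, a ∉ A → s'.arr a = s.arr a) ∧ s'.out = s.out

variable {X Y A B : List ℕ} {s₀ s' : State}

lemma Frame.refl (X A : List ℕ) (s : State) : Frame X A s s :=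
  ⟨fun _ _ => rfl, fun _ _ => rfl, rfl⟩

lemma Frame.trans (h : Frame X A s₀ s) (h' : Frame Y B s s') (hX : Y ⊆ X) (hA : B ⊆ A) :
    Frame X A s₀ s' :=
  ⟨fun x hx => (h'.1 x fun hy => hx (hX hy)).trans (h.1 x hx),
    fun a ha => (h'.2.1 a fun hb => ha (hA hb)).trans (h.2.1 a ha), h'.2.2.trans h.2.2⟩

lemma Frame.setVar (h : Frame X A s₀ s) {x : ℕ} (hx : x ∈ X) (v : ℕ) :
    Frame X A s₀ (s.setVar x v) :=
  ⟨fun y hy => by rw [setVar_var, if_neg (by rintro rfl; exact hy hx), h.1 y hy], h.2.1, h.2.2⟩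

lemma Frame.setArr (h : Frame X A s₀ s) {a : ℕ} (ha : a ∈ A) (i v : ℕ) :
    Frame X A s₀ (s.setArr a i v) :=
  ⟨h.1, fun b hb => by rw [setArr_arr_of_ne _ _ _ (by rintro rfl; exact hb ha), h.2.1 b hb], h.2.2⟩

/-- `acc := ∑ i < n, e`, where `pre` is run before each evaluation of `e`. -/
def sumN (i acc : ℕ) (pre : Prog) (e : Expr) : Prog :=
  .seq (.assign acc (.const 0)) (forN i (.seq pre (.assign acc (.add (.var acc) e))))

lemma WP.sumN {i acc n kp : ℕ} {pre : Prog} (X A : List ℕ) (val : ℕ → ℕ)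
    (hn : s.var 0 = n) (hM : n ≤ M) (hsum : ∑ k ∈ Finset.range n, val k ≤ M)
    (hi : i ∉ X) (hacc : acc ∉ X) (hne : i ≠ acc) (h0 : 0 ∉ i :: acc :: X)
    (hpre : ∀ k < n, ∀ s', Frame (i :: acc :: X) A s s' → s'.var i = k →
      WP M pre kp (fun s'' => Frame X A s' s'' ∧ e.eval s'' = val k) s')
    (hQ : ∀ s', Frame (i :: acc :: X) A s s' →
      s'.var acc = ∑ k ∈ Finset.range n, val k → Q s') :
    WP M (sumN i acc pre e) (n * (kp + e.steps + 2 * e.weight + 22) + 12) Q s := by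
  refine WP.mono (k := 2 + (n * ((kp + (e.steps + 2 * e.weight + 5) + 1) + 16) + 9) + 1) ?_
    (fun _ h => h) (by simp only [Nat.mul_add]; omega)
  refine WP.seq (WP.assign (Nat.zero_le _) ?_)
  refine WP.forN (fun k s' => Frame (i :: acc :: X) A s s' ∧
    s'.var acc = ∑ k ∈ Finset.range k, val k) hM ?_ ?_ ?_ ?_
  · exact fun k s' h => (h.1.1 0 h0).trans hn
  · refine ⟨((Frame.refl _ _ _).setVar (by simp) _).setVar (by simp) _, ?_⟩
    simp [hne.symm, Expr.eval]
  · rintro k hk s' _ ⟨hF, hs⟩ hik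
    refine WP.seq ((hpre k hk s' hF hik).imp ?_)
    rintro s'' ⟨hF', he⟩
    have hval : (Expr.add (.var acc) e).eval s'' = ∑ k ∈ Finset.range (k + 1), val k := by
      simp only [Expr.eval]
      rw [he, hF'.1 acc hacc, hs, Finset.sum_range_succ]
    refine WP.mono (WP.assign (Q := fun s' => s'.var i = k ∧
        Frame (i :: acc :: X) A s (s'.setVar i (k + 1)) ∧
          (s'.setVar i (k + 1)).var acc = ∑ k ∈ Finset.range (k + 1), val k) ?_ ?_)
      (fun _ h => h) ?_
    · rw [hval]
      exact (Finset.sum_le_sum_of_subset (Finset.range_subset_range.2 hk)).trans hsum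
    · refine ⟨?_, ?_, ?_⟩
      · rw [setVar_var, if_neg hne, hF'.1 i hi, hik]
      · exact (((hF.trans hF' (fun x hx => by simp [hx]) (List.Subset.refl _)).setVar
          (by simp) _).setVar (by simp) _)
      · simp [hne.symm, hval]
    · simp only [Expr.steps, Expr.weight]; omega
  · exact fun s' h => hQ s' h.1 h.2

end RAM

/-! ### Testing whether a set is a connected dominating set -/

section Spread

variable {n : ℕ} {G : SimpleGraph (Fin n)} {S : Finset (Fin n)}

/-- `C` contains all neighbours of the vertices of `C ∩ S`. -/
def SpreadClosed (G : SimpleGraph (Fin n)) (S : Finset (Fin n)) (C : Set (Fin n)) : Prop :=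
  ∀ u ∈ C, u ∈ S → ∀ w, G.Adj u w → w ∈ C

/-- The vertices reached from `R` in at most `k` steps, where each step leaves a vertex of `S`. -/
def spread (G : SimpleGraph (Fin n)) (S R : Finset (Fin n)) : ℕ → Set (Fin n)
  | 0 => R
  | k + 1 => spread G S R k ∪ {w | ∃ u ∈ spread G S R k, u ∈ S ∧ G.Adj u w}

lemma spread_mono (R : Finset (Fin n)) : Monotone (spread G S R) :=
  monotone_nat_of_le_succ fun _ => Set.subset_union_left

lemma mem_spread_of_walk {R : Finset (Fin n)} {a b : (S : Set (Fin n))}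
    (p : (G.induce (S : Set (Fin n))).Walk a b) (k : ℕ) (ha : a.1 ∈ spread G S R k) :
    b.1 ∈ spread G S R (k + p.length) := by
  induction p generalizing k with
  | nil => simpa using ha
  | @cons a c b h p ih =>
    have := ih (k + 1) (Or.inr ⟨a.1, ha, a.2, by simpa using h⟩)
    rwa [SimpleGraph.Walk.length_cons, Nat.add_comm p.length 1, ← Nat.add_assoc]

/-- Reaching every vertex from a root by steps that leave vertices of S expresses connectivity and
domination at once. R is only sandwiched between n rounds and the closed sets, because marking in
place may run ahead of the rounds. -/
lemma eq_univ_iff_isConnectedDominatingSet (hn : 0 < n) {r : Fin n} {R : Finset (Fin n)}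
    (hr : S.Nonempty → r ∈ S) (hR : spread G S ({r} ∩ S) n ⊆ R)
    (hC : ∀ C : Set (Fin n), (({r} ∩ S : Finset (Fin n)) : Set (Fin n)) ⊆ C →
      SpreadClosed G S C → (R : Set (Fin n)) ⊆ C) :
    R = Finset.univ ↔ IsConnectedDominatingSet G S := by
  constructor
  · rintro rfl
    have hne : S.Nonempty := by
      by_contra hS
      rw [Finset.not_nonempty_iff_eq_empty] at hS
      subst hS
      exact hC ∅ (by simp) (fun _ h => h.elim) (Finset.mem_coe.2 (Finset.mem_univ ⟨0, hn⟩))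
    have hrS := hr hne
    have key := hC {v | (∀ hv : v ∈ S, (G.induce (S : Set (Fin n))).Reachable ⟨r, hrS⟩ ⟨v, hv⟩) ∧
      (v ∉ S → ∃ u ∈ S, G.Adj v u)} ?_ ?_
    · exact ⟨fun v hv => (key (Finset.mem_coe.2 (Finset.mem_univ v))).2 hv,
        connected_induce_of_reachable hrS fun u hu =>
          (key (Finset.mem_coe.2 (Finset.mem_univ u))).1 hu⟩
    · intro v hv
      simp only [Finset.coe_inter, Finset.coe_singleton, Set.mem_inter_iff,
        Set.mem_singleton_iff, Finset.mem_coe] at hv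
      obtain ⟨rfl, hv⟩ := hv
      exact ⟨fun _ => SimpleGraph.Reachable.refl _, fun h => absurd hv h⟩
    · rintro u ⟨hu, -⟩ huS w huw
      refine ⟨fun hw => (hu huS).trans (SimpleGraph.Adj.reachable (by simpa using huw)),
        fun _ => ⟨u, huS, huw.symm⟩⟩
  · intro h
    obtain ⟨⟨x, hx⟩⟩ := h.2.nonempty
    have hrS := hr ⟨x, hx⟩
    -- Paths in G[S] have fewer than n edges, which leaves the last round for the vertices outside
    -- S.
    have key : ∀ v ∈ S, v ∈ spread G S ({r} ∩ S) (n - 1) := by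
      classical
      intro v hv
      obtain ⟨p, hp⟩ := (h.2.preconnected ⟨r, hrS⟩ ⟨v, hv⟩).exists_isPath
      have hlen := hp.length_lt
      have hcard : Fintype.card (S : Set (Fin n)) ≤ n := by
        simpa using Fintype.card_subtype_le (fun i : Fin n => i ∈ S)
      have := mem_spread_of_walk (R := {r} ∩ S) p 0 (by simp [spread, hrS])
      exact spread_mono _ (by omega) this
    refine Finset.eq_univ_iff_forall.2 fun v => hR ?_
    obtain ⟨m, rfl⟩ := Nat.exists_eq_succ_of_ne_zero hn.ne'
    by_cases hv : v ∈ S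
    · exact Or.inl (key v hv)
    · obtain ⟨u, hu, hvu⟩ := h.1 v hv
      exact Or.inr ⟨u, key u hu, hu, hvu.symm⟩

end Spread

open Classical in
lemma adjacencyArray_apply {n : ℕ} (G : SimpleGraph (Fin n)) (i j : Fin n) :
    adjacencyArray G (i * n + j) = if G.Adj i j then 1 else 0 := by
  unfold adjacencyArray
  congr 1
  refine propext ⟨?_, fun h => ⟨i, j, rfl, h⟩⟩
  rintro ⟨i', j', h, hadj⟩
  have hn : 0 < n := i.pos
  rw [Nat.mul_comm, Nat.mul_comm (i' : ℕ)] at h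
  have h1 := congrArg (· / n) h
  have h2 := congrArg (· % n) h
  simp only [Nat.mul_add_mod_self_left, Nat.mod_eq_of_lt j.2, Nat.mod_eq_of_lt j'.2] at h2
  simp only [Nat.mul_add_div hn, Nat.div_eq_of_lt j.2, Nat.div_eq_of_lt j'.2, Nat.add_zero] at h1
  rwa [Fin.ext h1, Fin.ext h2]

lemma adjacencyArray_le_one {n : ℕ} (G : SimpleGraph (Fin n)) (k : ℕ) :
    adjacencyArray G k ≤ 1 := by
  unfold adjacencyArray
  split_ifs <;> simp

/-! ### Reachability inside a set, computed on the machine -/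

namespace RAM

/-- The first `n` cells of an array hold the characteristic vector of `S`. -/
def IsCharArray {n : ℕ} (f : ℕ → ℕ) (S : Finset (Fin n)) : Prop :=
  ∀ i : Fin n, f i = if i ∈ S then 1 else 0

/-- The memory holds the input graphs, the multiples of `n` in the array `3`, and the
characteristic vector of `S` in the array `2`. -/
structure Holds {n : ℕ} (G G' : SimpleGraph (Fin n)) (S : Finset (Fin n)) (s : State) : Prop where
  var_zero : s.var 0 = n
  arr_zero : s.arr 0 = adjacencyArray G
  arr_one : s.arr 1 = adjacencyArray G'
  arr_two : IsCharArray (s.arr 2) S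
  arr_three : ∀ k < n, s.arr 3 k = k * n

variable {n M : ℕ} {G G' : SimpleGraph (Fin n)} {S R : Finset (Fin n)} {s s' : State}

lemma Holds.of_frame {X A : List ℕ} (h : Holds G G' S s) (hF : Frame X A s s') (hX : 0 ∉ X)
    (h0 : 0 ∉ A) (h1 : 1 ∉ A) (h2 : 2 ∉ A) (h3 : 3 ∉ A) : Holds G G' S s' where
  var_zero := (hF.1 0 hX).trans h.var_zero
  arr_zero := (hF.2.1 0 h0).trans h.arr_zero
  arr_one := (hF.2.1 1 h1).trans h.arr_one
  arr_two := by rw [hF.2.1 2 h2]; exact h.arr_two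
  arr_three := by rw [hF.2.1 3 h3]; exact h.arr_three

lemma IsCharArray.sum_eq_card {f : ℕ → ℕ} (h : IsCharArray f S) :
    ∑ k ∈ Finset.range n, f k = S.card := by
  rw [Finset.sum_range, Finset.sum_congr rfl fun i _ => h i]
  simp

/-- The entry in row `x` and column `y` of the adjacency matrix in the array `g`. -/
def adjExpr (g x y : ℕ) : Expr := .arr g (.add (.arr 3 (.var x)) (.var y))

open Classical in
lemma Holds.adjExpr_zero (h : Holds G G' S s) {x y : ℕ} {i j : Fin n} (hx : s.var x = i)
    (hy : s.var y = j) : (adjExpr 0 x y).eval s = if G.Adj i j then 1 else 0 := by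
  simp only [adjExpr, Expr.eval, hx, hy]
  rw [h.arr_zero, h.arr_three _ i.2, adjacencyArray_apply]

open Classical in
lemma Holds.adjExpr_one (h : Holds G G' S s) {x y : ℕ} {i j : Fin n} (hx : s.var x = i)
    (hy : s.var y = j) : (adjExpr 1 x y).eval s = if G'.Adj i j then 1 else 0 := by
  simp only [adjExpr, Expr.eval, hx, hy]
  rw [h.arr_one, h.arr_three _ i.2, adjacencyArray_apply]

/-- Choose a root in the set, if it is non-empty, and mark the root if it lies in the set. -/
def initMarks : Prog :=
  .seq (.assign 7 (.const 0))
    (.seq (forN 9 (.seq (.ite (.arr 2 (.var 9)) (.assign 7 (.var 9)) .skip)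
      (.store 4 (.var 9) (.const 0))))
      -- For the empty set the root stays 0 and receives the mark 0.
      (.store 4 (.var 7) (.arr 2 (.var 7))))

lemma wp_initMarks (hn : 0 < n) (hM : n ≤ M) (h : Holds G G' S s) :
    WP M initMarks (n * 30 + 30) (fun s' => Frame [7, 9] [4] s s' ∧
      ∃ r : Fin n, (S.Nonempty → r ∈ S) ∧ IsCharArray (s'.arr 4) ({r} ∩ S)) s := by
  refine WP.mono (k := 2 + ((n * (13 + 16) + 9) + 7 + 1) + 1) ?_ (fun _ h => h) (by omega)
  refine WP.seq (WP.assign (Nat.zero_le _) ?_)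
  refine WP.seq (k := n * (13 + 16) + 9) (k' := 7) ?_
  refine WP.forN (fun k s' => Frame [7, 9] [4] s s' ∧ s'.var 7 < n ∧
    (∀ w < k, s'.arr 4 w = 0) ∧ ((∃ w < k, s.arr 2 w ≠ 0) → s.arr 2 (s'.var 7) ≠ 0)) hM
    ?_ ?_ ?_ ?_
  · exact fun k s' hs' => (hs'.1.1 0 (by simp)).trans h.var_zero
  · refine ⟨((Frame.refl _ _ _).setVar (by simp) _).setVar (by simp) _, ?_, by simp, by simp⟩
    simpa [Expr.eval] using hn
  · rintro k hk s' hs ⟨hF, h7, h4, h2⟩ hi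
    refine WP.seq (k := 8) (k' := 4) (WP.ite (k := 3) (k' := 1) (fun he => ?_) (fun he => ?_))
    · refine WP.assign (by simp only [Expr.eval]; omega) ?_
      refine WP.store (by simp [Expr.eval]) ⟨by simpa using hi, ?_, ?_, ?_, ?_⟩
      · exact ((hF.setVar (by simp) _).setArr (by simp) _ _).setVar (by simp) _
      · simpa [Expr.eval, hi] using hk
      · intro w hw
        have h97 : (9 : ℕ) ≠ 7 := by decide
        simp only [Expr.eval, setVar_arr, setArr_arr, setVar_var, true_and, if_neg h97, hi]
        split_ifs with hc
        · rfl
        · exact h4 w (by omega)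
      · intro _
        simp only [Expr.eval, hi] at he
        rw [hF.2.1 2 (by simp)] at he
        simpa [Expr.eval, hi] using he
    · refine WP.skip ?_
      refine WP.store (by simp [Expr.eval]) ⟨by simpa using hi, ?_, ?_, ?_, ?_⟩
      · exact (hF.setArr (by simp) _ _).setVar (by simp) _
      · simpa [Expr.eval, hi] using h7
      · intro w hw
        simp only [Expr.eval, setVar_arr, setArr_arr, true_and]
        split_ifs with hc
        · rfl
        · exact h4 w (by omega)
      · rintro ⟨w, hw, hw2⟩
        simp only [Expr.eval, hi] at he
        rw [hF.2.1 2 (by simp)] at he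
        have hwk : w ≠ k := by rintro rfl; exact hw2 he
        simpa [Expr.eval] using h2 ⟨w, by omega, hw2⟩
  · rintro s' ⟨hF, h7, h4, h2⟩
    have hval := h.arr_two ⟨s'.var 7, h7⟩
    simp only at hval
    refine WP.store ?_ ⟨hF.setArr (by simp) _ _, ⟨s'.var 7, h7⟩, ?_, ?_⟩
    · simp only [Expr.eval]
      rw [hF.2.1 2 (by simp), hval]
      split_ifs <;> omega
    · rintro ⟨x, hx⟩
      have := h2 ⟨x, x.2, by rw [h.arr_two x, if_pos hx]; simp⟩
      rw [hval] at this
      simpa using this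
    · intro i
      simp only [Expr.eval, setArr_arr, true_and]
      rw [hF.2.1 2 (by simp), hval]
      by_cases hi : (i : ℕ) = s'.var 7
      · have : i = ⟨s'.var 7, h7⟩ := Fin.ext hi
        rw [if_pos hi, ← this]
        simp
      · have : i ≠ ⟨s'.var 7, h7⟩ := fun e => hi (congrArg Fin.val e)
        rw [if_neg hi, h4 i i.2]
        simp [this]

/-- Mark all neighbours of all marked vertices of the set. -/
def spreadMarks : Prog :=
  forN 9 (forN 10 (.ite
    -- The conjunction of three bits: their sum minus 2, truncated.
    (.sub (.add (.add (.arr 4 (.var 9)) (.arr 2 (.var 9))) (adjExpr 0 9 10)) (.const 2))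
    (.store 4 (.var 10) (.const 1)) .skip))

/-- The memory after marking the neighbours of all vertices before `k` and of those neighbours of
`k` that are before `l`. -/
def PartialSpread (G : SimpleGraph (Fin n)) (S R : Finset (Fin n)) (s : State) (k l : ℕ)
    (s' : State) : Prop :=
  Frame [9, 10] [4] s s' ∧ ∃ R' : Finset (Fin n), IsCharArray (s'.arr 4) R' ∧ R ⊆ R' ∧
    (∀ u ∈ R, u ∈ S → ∀ w, G.Adj u w → (u : ℕ) < k ∨ (u : ℕ) = k ∧ (w : ℕ) < l → w ∈ R') ∧
    ∀ C : Set (Fin n), (R : Set (Fin n)) ⊆ C → SpreadClosed G S C → (R' : Set (Fin n)) ⊆ C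

lemma PartialSpread.setVar {k l x v : ℕ} (h : PartialSpread G S R s k l s')
    (hx : x ∈ [9, 10]) : PartialSpread G S R s k l (s'.setVar x v) :=
  ⟨h.1.setVar hx v, h.2⟩

lemma wp_spreadMarks (hM : n ≤ M) (hM1 : 1 ≤ M) (h : Holds G G' S s)
    (hR : IsCharArray (s.arr 4) R) :
    WP M spreadMarks (n * (n * 56 + 25) + 9) (PartialSpread G S R s n 0) s := by
  classical
  have hvar : ∀ {k l : ℕ} {s'}, PartialSpread G S R s k l s' → s'.var 0 = n := fun hs' =>
    (hs'.1.1 0 (by simp)).trans h.var_zero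
  refine WP.forN (fun k => PartialSpread G S R s k 0) hM (fun k s' hs' => hvar hs') ?_ ?_
    (fun _ h => h)
  · exact ⟨(Frame.refl _ _ _).setVar (by simp) _, R, hR, subset_rfl, fun _ _ _ _ _ h => by omega,
      fun _ h _ => h⟩
  · intro k hk s' _ hs' h9
    refine WP.forN (kb := 40)
      (fun l s' => s'.var 9 = k ∧ PartialSpread G S R s k l s') hM (fun l s' hs' => hvar hs'.2)
      ⟨by simpa using h9, hs'.setVar (by simp)⟩ ?_ ?_
    · rintro l hl s' _ ⟨h9, hF, R', hR', hsub, hnb, hcl⟩ h10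
      have hH : Holds G G' S s' := h.of_frame hF (by simp) (by simp) (by simp) (by simp) (by simp)
      have hadj := hH.adjExpr_zero (x := 9) (y := 10) (i := ⟨k, hk⟩) (j := ⟨l, hl⟩) h9 h10
      have h4k := hR' ⟨k, hk⟩
      have h2k := hH.arr_two ⟨k, hk⟩
      simp only at h4k h2k
      refine WP.ite (k := 6) (k' := 1) (fun he => ?_) (fun he => ?_)
      · simp only [Expr.eval, h9, hadj, h4k, h2k] at he
        have hk1 : (⟨k, hk⟩ : Fin n) ∈ R' := by
          by_contra hc; rw [if_neg hc] at he; split_ifs at he <;> omega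
        have hk2 : (⟨k, hk⟩ : Fin n) ∈ S := by
          by_contra hc; rw [if_neg hc] at he; split_ifs at he <;> omega
        have hk3 : G.Adj ⟨k, hk⟩ ⟨l, hl⟩ := by
          by_contra hc
          rw [if_neg hc] at he
          split_ifs at he
          omega
        refine WP.store (by simpa [Expr.eval] using hM1) ⟨by simpa using h10, by simpa using h9,
          (hF.setArr (by simp) _ _).setVar (by simp) _, insert ⟨l, hl⟩ R', ?_,
          hsub.trans (Finset.subset_insert _ _), ?_, ?_⟩
        · intro i
          simp only [Expr.eval, setVar_arr, setArr_arr, h10, true_and, Finset.mem_insert]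
          by_cases hil : (i : ℕ) = l
          · rw [if_pos hil, if_pos (Or.inl (Fin.ext hil))]
          · rw [if_neg hil, hR' i]
            exact if_congr (by simp [Fin.ext_iff, hil]) rfl rfl
        · intro u hu huS w huw hkl
          rw [Finset.mem_insert]
          by_cases hwl : (w : ℕ) = l
          · exact Or.inl (Fin.ext hwl)
          · exact Or.inr (hnb u hu huS w huw (by omega))
        · intro C hRC hC
          rw [Finset.coe_insert]
          exact Set.insert_subset (hC _ (hcl C hRC hC hk1) hk2 _ hk3) (hcl C hRC hC)
      · refine WP.skip ⟨h10, by simpa using h9, hF.setVar (by simp) _, R', hR', hsub, ?_, hcl⟩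
        intro u hu huS w huw hkl
        by_cases hc : (u : ℕ) = k ∧ (w : ℕ) = l
        · exfalso
          have hu' : u = ⟨k, hk⟩ := Fin.ext hc.1
          have hw' : w = ⟨l, hl⟩ := Fin.ext hc.2
          simp only [Expr.eval, h9, hadj, h4k, h2k] at he
          rw [← hu', ← hw', if_pos (hsub hu), if_pos huS, if_pos huw] at he
          omega
        · exact hnb u hu huS w huw (by omega)
    · rintro s' ⟨h9, hs'⟩
      refine ⟨h9, PartialSpread.setVar ?_ (by simp)⟩
      obtain ⟨hF, R', hR', hsub, hnb, hcl⟩ := hs'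
      exact ⟨hF, R', hR', hsub, fun u hu huS w huw hkl => hnb u hu huS w huw (by omega), hcl⟩

/-- Compute in the variable `11` the number of vertices reached from the root of the set. -/
def countReached : Prog :=
  .seq initMarks (.seq (forN 8 spreadMarks) (sumN 9 11 .skip (.arr 4 (.var 9))))

/-- A bound for the running time of `countReached`, up to the size of the numbers. -/
def countReachedCost (n : ℕ) : ℕ := n * (n * (n * 56 + 25) + 85) + 60

lemma wp_countReached (hn : 0 < n) (hM : n ≤ M) (h : Holds G G' S s) :
    WP M countReached (countReachedCost n) (fun s' =>
      Frame [7, 8, 9, 10, 11] [4] s s' ∧ s'.var 11 ≤ n ∧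
        (s'.var 11 = n ↔ IsConnectedDominatingSet G S)) s := by
  refine WP.mono (k := (n * 30 + 30) + ((n * ((n * (n * 56 + 25) + 9) + 16) + 9) +
    (n * (1 + 3 + 2 * 1 + 22) + 12) + 1) + 1) ?_ (fun _ h => h)
    (by simp only [countReachedCost, Nat.mul_add]; omega)
  refine WP.seq ((wp_initMarks hn hM h).imp ?_)
  rintro s₁ ⟨hF₁, r, hr, hr4⟩
  have hH₁ : Holds G G' S s₁ := h.of_frame hF₁ (by simp) (by simp) (by simp) (by simp) (by simp)
  refine WP.seq (WP.forN (fun k s' => Frame [8, 9, 10] [4] s₁ s' ∧ ∃ R : Finset (Fin n),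
    IsCharArray (s'.arr 4) R ∧ spread G S ({r} ∩ S) k ⊆ R ∧
    ∀ C : Set (Fin n), (({r} ∩ S : Finset (Fin n)) : Set (Fin n)) ⊆ C →
      SpreadClosed G S C → (R : Set (Fin n)) ⊆ C) hM ?_ ?_ ?_ ?_)
  · exact fun k s' hs' => (hs'.1.1 0 (by simp)).trans hH₁.var_zero
  · exact ⟨(Frame.refl _ _ _).setVar (by simp) _, _, hr4, subset_rfl, fun _ h _ => h⟩
  · rintro k hk s' _ ⟨hF, R, hR, hsp, hcl⟩ h8
    have hH : Holds G G' S s' := hH₁.of_frame hF (by simp) (by simp) (by simp) (by simp) (by simp)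
    refine (wp_spreadMarks hM (by omega) hH hR).imp ?_
    rintro s'' ⟨hF', R', hR', hsub, hnb, hcl'⟩
    refine ⟨(hF'.1 8 (by simp)).trans h8,
      (hF.trans hF' (by simp) (by simp)).setVar (by simp) _, R', hR', ?_, ?_⟩
    · rintro v (hv | ⟨u, hu, huS, huv⟩)
      · exact hsub (hsp hv)
      · exact hnb u (hsp hu) huS v huv (Or.inl u.2)
    · exact fun C hRC hC => hcl' C (hcl C hRC hC) hC
  · rintro s₂ ⟨hF₂, R, hR, hsp, hcl⟩
    have hH₂ : Holds G G' S s₂ :=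
      hH₁.of_frame hF₂ (by simp) (by simp) (by simp) (by simp) (by simp)
    have hsum := hR.sum_eq_card
    have hRn : R.card ≤ n := by simpa using Finset.card_le_univ R
    refine WP.sumN [] [] (s₂.arr 4) hH₂.var_zero hM (by omega) (by simp) (by simp) (by simp)
      (by simp) ?_ ?_
    · intro k _ s' hF hk
      refine WP.skip ⟨Frame.refl _ _ _, ?_⟩
      simp [Expr.eval, hk, hF.2.1 4 (by simp)]
    · intro s₃ hF₃ h11
      rw [hsum] at h11
      refine ⟨(((Frame.refl _ _ _).trans hF₁ (by simp) (by simp)).trans hF₂ (by simp) (by simp)).trans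
        hF₃ (by simp) (by simp), by omega, ?_⟩
      rw [h11, ← eq_univ_iff_isConnectedDominatingSet hn hr hsp hcl, ← Finset.card_eq_iff_eq_univ,
        Fintype.card_fin]

lemma countReachedCost_le (hn : 0 < n) : countReachedCost n ≤ 226 * n ^ 3 := by
  obtain ⟨m, rfl⟩ := Nat.exists_eq_succ_of_ne_zero hn.ne'
  simp only [countReachedCost, Nat.succ_eq_add_one]
  ring_nf
  omega

attribute [irreducible] countReachedCost

end RAM

/-! ### Testing minimality and sparsity, and listing the members of a set -/

namespace RAM

variable {n M : ℕ} {G G' : SimpleGraph (Fin n)} {S : Finset (Fin n)} {s s' : State}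

/-- Remove the vertex in the variable `12` from the set, count the vertices reached from the root of
the remaining set, and put the vertex back. -/
def countReachedWithout : Prog :=
  .seq (.assign 13 (.arr 2 (.var 12))) (.seq (.store 2 (.var 12) (.const 0))
    (.seq countReached (.store 2 (.var 12) (.var 13))))

lemma wp_countReachedWithout (hn : 0 < n) (hM : n ≤ M) (h : Holds G G' S s) {v : Fin n}
    (hv : s.var 12 = v) :
    WP M countReachedWithout (countReachedCost n + 17) (fun s' =>
      Frame [7, 8, 9, 10, 11, 13] [4] s s' ∧ s'.var 13 = (if v ∈ S then 1 else 0) ∧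
        s'.var 11 ≤ n ∧ (s'.var 11 = n ↔ IsConnectedDominatingSet G (S.erase v))) s := by
  have h2v := h.arr_two v
  have h13 : (s.arr 2 v) ≤ M := by
    rw [h2v]; split_ifs <;> omega
  refine WP.mono (k := 5 + (4 + (countReachedCost n + 5 + 1) + 1) + 1) ?_
    (fun _ h => h) (by omega)
  refine WP.seq (WP.assign (by simpa [Expr.eval, hv] using h13) ?_)
  refine WP.seq (WP.store (Nat.zero_le _) ?_)
  simp only [Expr.eval, setVar_var, hv, if_neg (show (12 : ℕ) ≠ 13 by decide)]
  have hH : Holds G G' (S.erase v) ((s.setVar 13 (s.arr 2 v)).setArr 2 v 0) := by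
    refine ⟨by simpa using h.var_zero, ?_, ?_, ?_, ?_⟩
    · rw [setArr_arr_of_ne _ _ _ (by decide)]; exact h.arr_zero
    · rw [setArr_arr_of_ne _ _ _ (by decide)]; exact h.arr_one
    · intro i
      simp only [setArr_arr, setVar_arr, true_and, Finset.mem_erase]
      by_cases hi : (i : ℕ) = v
      · rw [if_pos hi, if_neg fun hc => hc.1 (Fin.ext hi)]
      · rw [if_neg hi, h.arr_two i]
        exact if_congr (by simp [Fin.ext_iff, hi]) rfl rfl
    · rw [setArr_arr_of_ne _ _ _ (by decide)]; exact h.arr_three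
  refine WP.seq ((wp_countReached hn hM hH).imp ?_)
  rintro s₁ ⟨hF, hle, hiff⟩
  have h12 : s₁.var 12 = v := (hF.1 12 (by simp)).trans (by simpa using hv)
  have h13' : s₁.var 13 = s.arr 2 v := (hF.1 13 (by simp)).trans (by simp)
  refine WP.store (by simpa [Expr.eval, h13'] using h13) ⟨⟨?_, ?_, ?_⟩, ?_, ?_, ?_⟩
  · intro x hx
    simp only [List.mem_cons, List.not_mem_nil, or_false, not_or] at hx
    rw [setArr_var, hF.1 x (by simp; tauto), setArr_var, setVar_var, if_neg (by tauto)]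
  -- Array 2 is altered twice, and the last store undoes the first.
  · intro a ha
    funext k
    have h2 := hF.2.1 2 (by simp)
    simp only [Expr.eval, setArr_arr, h12, h13']
    by_cases ha2 : a = 2
    · subst ha2
      rw [h2]
      simp only [setArr_arr, setVar_arr, true_and]
      split_ifs with hk
      · rw [hk]
      · rfl
    · rw [if_neg fun hc => ha2 hc.1, hF.2.1 a ha, setArr_arr_of_ne _ _ _ ha2, setVar_arr]
  · rw [setArr_out, hF.2.2, setArr_out, setVar_out]
  · rw [setArr_var, h13', h2v]
  · simpa using hle
  · simpa using hiff

/-- Compute in the variable `14` the number of vertices of the set whose removal leaves a connected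
dominating set, and in the variable `11` the number of vertices reached from the root of the set. -/
def testMinimal : Prog :=
  .seq (sumN 12 14 countReachedWithout
    -- The conjunction of two bits: the vertex lies in the set, and all n vertices are reached
    -- without it.
    (.sub (.add (.var 13) (.sub (.const 1) (.sub (.var 0) (.var 11)))) (.const 1))) countReached

/-- After `testMinimal`, this is non-zero for minimal connected dominating sets only. -/
def isMinimalExpr : Expr := .sub (.sub (.const 1) (.sub (.var 0) (.var 11))) (.var 14)

lemma wp_testMinimal (hn : 0 < n) (hM : n ≤ M) (h : Holds G G' S s) :
    WP M testMinimal ((n + 1) * (countReachedCost n + 140)) (fun s' =>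
      Frame [7, 8, 9, 10, 11, 12, 13, 14] [4] s s' ∧
        (isMinimalExpr.eval s' ≠ 0 ↔ IsMinimalCDS G S)) s := by
  classical
  refine WP.mono (k := (n * ((countReachedCost n + 17) + 25 + 2 * 5 + 22) + 12) +
    countReachedCost n + 1) ?_ (fun _ h => h)
    (by simp only [Nat.add_mul, Nat.mul_add]; omega)
  set val : ℕ → ℕ := fun k => if ∃ v ∈ S, (v : ℕ) = k ∧ IsConnectedDominatingSet G (S.erase v)
    then 1 else 0 with hval
  refine WP.seq (WP.sumN [7, 8, 9, 10, 11, 13] [4] val h.var_zero hM ?_ (by simp) (by simp)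
    (by simp) (by simp) ?_ ?_)
  · refine (Finset.sum_le_card_nsmul _ _ 1 fun k _ => ?_).trans (by simpa using hM)
    simp only [hval]
    split_ifs <;> simp
  · intro k hk s' hF h12
    have hH : Holds G G' S s' := h.of_frame hF (by simp) (by simp) (by simp) (by simp) (by simp)
    refine (wp_countReachedWithout hn hM hH (v := ⟨k, hk⟩) h12).imp ?_
    rintro s'' ⟨hF', h13, hle, hiff⟩
    refine ⟨hF', ?_⟩
    have h0 : s''.var 0 = n := (hF'.1 0 (by simp)).trans hH.var_zero
    simp only [Expr.eval, h13, h0, hval]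
    by_cases hkS : (⟨k, hk⟩ : Fin n) ∈ S
    · rw [if_pos hkS]
      by_cases hc : IsConnectedDominatingSet G (S.erase ⟨k, hk⟩)
      · rw [if_pos ⟨_, hkS, rfl, hc⟩, hiff.2 hc]
        omega
      · rw [if_neg]
        · have := mt hiff.1 hc
          omega
        · rintro ⟨v, hv, rfl, hv'⟩
          exact hc hv'
    · rw [if_neg hkS, if_neg]
      · omega
      · rintro ⟨v, hv, rfl, hv'⟩
        exact hkS hv
  · intro s₁ hF₁ h14
    have hH : Holds G G' S s₁ := h.of_frame hF₁ (by simp) (by simp) (by simp) (by simp) (by simp)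
    refine (wp_countReached hn hM hH).imp ?_
    rintro s₂ ⟨hF₂, hle, hiff⟩
    refine ⟨((Frame.refl _ _ _).trans hF₁ (by simp) (by simp)).trans hF₂ (by simp) (by simp), ?_⟩
    have h0 : s₂.var 0 = n := (hF₂.1 0 (by simp)).trans hH.var_zero
    have h14' : s₂.var 14 = ∑ k ∈ Finset.range n, val k := (hF₂.1 14 (by simp)).trans h14
    have hzero : ∑ k ∈ Finset.range n, val k = 0 ↔
        ∀ v ∈ S, ¬ IsConnectedDominatingSet G (S.erase v) := by
      rw [Finset.sum_eq_zero_iff]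
      constructor
      · intro hz v hv hc
        have := hz v (Finset.mem_range.2 v.2)
        simp only [hval] at this
        rw [if_pos ⟨v, hv, rfl, hc⟩] at this
        exact one_ne_zero this
      · intro hz k _
        simp only [hval]
        rw [if_neg]
        rintro ⟨v, hv, -, hc⟩
        exact hz v hv hc
    rw [isMinimalCDS_iff, ← hiff, ← hzero]
    simp only [isMinimalExpr, Expr.eval, h0, h14']
    omega

/-- Compute the size of the set in the variable `5`, and in the variable `4` the number of vertices
with at most two neighbours in the set. -/
def testSparse : Prog :=
  .seq (sumN 2 5 .skip (.arr 2 (.var 2)))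
    (sumN 1 4 (sumN 2 3 .skip (.sub (.add (adjExpr 1 1 2) (.arr 2 (.var 2))) (.const 1)))
      -- This is 1 if the count is at most two, and 0 otherwise.
      (.sub (.const 1) (.sub (.var 3) (.const 2))))

/-- After `testSparse`, this is non-zero for sparse sets only. -/
def isSparseExpr : Expr :=
  -- The added 1 makes the truncated difference non-zero also when |S| = 4 `sparseCount`.
  .sub (.add (.const 1) (.add (.add (.var 4) (.var 4)) (.add (.var 4) (.var 4)))) (.var 5)

lemma wp_testSparse (hM : n ≤ M) (h : Holds G G' S s) :
    WP M testSparse (n * (n * 70 + 120) + 40) (fun s' =>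
      Frame [1, 2, 3, 4, 5] [] s s' ∧ (isSparseExpr.eval s' ≠ 0 ↔ IsSparse G' S)) s := by
  classical
  refine WP.mono (k := (n * (1 + 3 + 2 * 1 + 22) + 12) + (n * ((n * (1 + 22 + 2 * 3 + 22) + 12) +
    15 + 2 * 4 + 22) + 12) + 1) ?_ (fun _ h => h)
    (by norm_num; nlinarith)
  have hsum := h.arr_two.sum_eq_card
  have hSn : S.card ≤ n := by simpa using Finset.card_le_univ S
  refine WP.seq (WP.sumN [] [] (s.arr 2) h.var_zero hM (by omega) (by simp) (by simp) (by simp)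
    (by simp) ?_ ?_)
  · intro k _ s' hF hk
    refine WP.skip ⟨Frame.refl _ _ _, ?_⟩
    simp [Expr.eval, hk, hF.2.1 2 (by simp)]
  intro s₁ hF₁ h5
  rw [hsum] at h5
  have hH₁ : Holds G G' S s₁ := h.of_frame hF₁ (by simp) (by simp) (by simp) (by simp) (by simp)
  set val : ℕ → ℕ := fun k => if ∃ v : Fin n, (v : ℕ) = k ∧ neighborCount G' S v ≤ 2
    then 1 else 0 with hval
  have hvs : ∑ k ∈ Finset.range n, val k = sparseCount G' S := by
    rw [Finset.sum_range, sparseCount, Finset.card_filter]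
    refine Finset.sum_congr rfl fun v _ => if_congr ⟨?_, fun h => ⟨v, rfl, h⟩⟩ rfl rfl
    rintro ⟨w, hw, h⟩
    rwa [← Fin.ext hw]
  refine WP.sumN [2, 3] [] val hH₁.var_zero hM ?_ (by simp) (by simp) (by simp) (by simp) ?_ ?_
  · rw [hvs]
    exact (Finset.card_le_univ _).trans (by simpa using hM)
  · intro k hk s₂ hF₂ h1
    have hH₂ : Holds G G' S s₂ :=
      hH₁.of_frame hF₂ (by simp) (by simp) (by simp) (by simp) (by simp)
    set val' : ℕ → ℕ := fun l => if ∃ u ∈ S, (u : ℕ) = l ∧ G'.Adj ⟨k, hk⟩ u then 1 else 0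
      with hval'
    have hvs' : ∑ l ∈ Finset.range n, val' l = neighborCount G' S ⟨k, hk⟩ := by
      rw [Finset.sum_range, neighborCount, ← Finset.univ_inter S, ← Finset.filter_mem_eq_inter,
        Finset.filter_filter, Finset.card_filter]
      refine Finset.sum_congr rfl fun v _ => if_congr ⟨?_, fun h => ⟨v, h.1, rfl, h.2⟩⟩ rfl rfl
      rintro ⟨w, hwS, hw, h⟩
      rw [← Fin.ext hw]
      exact ⟨hwS, h⟩
    refine WP.sumN [] [] val' hH₂.var_zero hM ?_ (by simp) (by simp) (by simp) (by simp) ?_ ?_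
    · rw [hvs']
      exact (Finset.card_filter_le _ _).trans (hSn.trans hM)
    · intro l hl s₃ hF₃ h2
      have hH₃ : Holds G G' S s₃ :=
        hH₂.of_frame hF₃ (by simp) (by simp) (by simp) (by simp) (by simp)
      refine WP.skip ⟨Frame.refl _ _ _, ?_⟩
      have hadj := hH₃.adjExpr_one (x := 1) (y := 2) (i := ⟨k, hk⟩) (j := ⟨l, hl⟩)
        ((hF₃.1 1 (by simp)).trans h1) h2
      have h2l := hH₃.arr_two ⟨l, hl⟩
      simp only at h2l
      simp only [Expr.eval, hadj, h2, h2l, hval']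
      by_cases hlS : (⟨l, hl⟩ : Fin n) ∈ S
      · by_cases hA : G'.Adj ⟨k, hk⟩ ⟨l, hl⟩
        · rw [if_pos hlS, if_pos hA, if_pos ⟨_, hlS, rfl, hA⟩]
        · rw [if_pos hlS, if_neg hA, if_neg]
          rintro ⟨u, huS, rfl, hu⟩
          exact hA hu
      · rw [if_neg hlS, if_neg (c := ∃ u ∈ S, (u : ℕ) = l ∧ G'.Adj ⟨k, hk⟩ u)]
        · split_ifs <;> rfl
        · rintro ⟨u, huS, rfl, hu⟩
          exact hlS huS
    · intro s₃ hF₃ h3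
      refine ⟨hF₃, ?_⟩
      rw [hvs'] at h3
      simp only [Expr.eval, h3, hval]
      split_ifs with hc
      · obtain ⟨v, hv, hc⟩ := hc
        rw [show v = ⟨k, hk⟩ from Fin.ext hv] at hc
        omega
      · have : ¬ neighborCount G' S ⟨k, hk⟩ ≤ 2 := fun hc' => hc ⟨_, rfl, hc'⟩
        omega
  · intro s₂ hF₂ h4
    refine ⟨((Frame.refl _ _ _).trans hF₁ (by simp) (by simp)).trans hF₂ (by simp) (by simp), ?_⟩
    have h5' : s₂.var 5 = S.card := (hF₂.1 5 (by simp)).trans h5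
    rw [hvs] at h4
    simp only [isSparseExpr, Expr.eval, h4, h5', IsSparse]
    omega

/-- Output the characteristic vector of the set. -/
def outputSet : Prog := forN 15 (.output (.arr 2 (.var 15)))

lemma wp_outputSet (hM : n ≤ M) (h : Holds G G' S s) :
    WP M outputSet (n * 30 + 9) (fun s' => (∀ x ≠ 15, s'.var x = s.var x) ∧ s'.arr = s.arr ∧
      s'.out = s.out ++ charVector S) s := by
  refine WP.mono (k := n * (5 + 16) + 9) ?_ (fun _ h => h) (by omega)
  refine WP.forN (fun k s' => (∀ x ≠ 15, s'.var x = s.var x) ∧ s'.arr = s.arr ∧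
      s'.out = s.out ++ (List.range k).map (s.arr 2)) hM ?_ ?_ ?_ ?_
  · exact fun k s' hs' => (hs'.1 0 (by simp)).trans h.var_zero
  · exact ⟨fun x hx => by simp [hx], rfl, by simp⟩
  · rintro k hk s' _ ⟨hv, ha, ho⟩ h15
    refine WP.output ⟨h15, fun x hx => ?_, ha, ?_⟩
    · simpa [State.emit, hx] using hv x hx
    · simp [State.emit, Expr.eval, h15, ha, ho, List.range_succ]
  · rintro s' ⟨hv, ha, ho⟩
    refine ⟨hv, ha, ?_⟩
    rw [ho, charVector]
    congr 1
    refine List.ext_getElem (by simp) fun i h1 h2 => ?_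
    simp only [List.getElem_map, List.getElem_range, List.getElem_ofFn]
    exact h.arr_two ⟨i, by simpa using h1⟩

/-- Output the set if it is a minimal connected dominating set. -/
def outputMinimal : Prog := .seq testMinimal (.ite isMinimalExpr outputSet .skip)

open Classical in
lemma wp_outputMinimal (hn : 0 < n) (hM : n ≤ M) (h : Holds G G' S s) :
    WP M outputMinimal ((n + 1) * (countReachedCost n + 240)) (fun s' =>
      (∀ x < 7, s'.var x = s.var x) ∧ (∀ a < 4, s'.arr a = s.arr a) ∧
        s'.out = s.out ++ if IsMinimalCDS G S then charVector S else []) s := by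
  refine WP.mono (k := ((n + 1) * (countReachedCost n + 140)) +
    (17 + (n * 30 + 9) + 1 + 1) + 1) ?_ (fun _ h => h)
    (by simp only [Nat.add_mul, Nat.mul_add]; omega)
  refine WP.seq ((wp_testMinimal hn hM h).imp ?_)
  rintro s₁ ⟨hF, hiff⟩
  have hH : Holds G G' S s₁ := h.of_frame hF (by simp) (by simp) (by simp) (by simp) (by simp)
  have hvar : ∀ x < 7, s₁.var x = s.var x := fun x hx => hF.1 x (by simp; omega)
  have harr : ∀ a < 4, s₁.arr a = s.arr a := fun a ha => hF.2.1 a (by simp; omega)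
  refine WP.ite (fun he => ?_) fun he => ?_
  · refine (wp_outputSet hM hH).imp ?_
    rintro s₂ ⟨hv, ha, ho⟩
    refine ⟨fun x hx => (hv x (by omega)).trans (hvar x hx), fun a h4 => ha ▸ harr a h4, ?_⟩
    rw [ho, hF.2.2, if_pos (hiff.1 he)]
  · refine WP.skip ⟨hvar, harr, ?_⟩
    rw [hF.2.2, if_neg fun hc => hiff.2 hc he, List.append_nil]

end RAM

/-! ### Binary numbers as sets of vertices -/

section Bits

variable {n : ℕ}

/-- The set of the positions below `n` of the ones in the binary expansion of `x`. -/
def bitSet (n x : ℕ) : Finset (Fin n) := Finset.univ.filter fun i => x.testBit i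

lemma mem_bitSet {x : ℕ} {i : Fin n} : i ∈ bitSet n x ↔ x.testBit i := by simp [bitSet]

lemma bitSet_injOn : Set.InjOn (bitSet n) {x | x < 2 ^ n} := by
  intro x hx y hy h
  refine Nat.eq_of_testBit_eq fun i => ?_
  rcases lt_or_ge i n with hi | hi
  · have := Finset.ext_iff.1 h ⟨i, hi⟩
    rw [mem_bitSet, mem_bitSet] at this
    exact Bool.eq_iff_iff.2 this
  · have hpow : 2 ^ n ≤ 2 ^ i := Nat.pow_le_pow_right two_pos hi
    rw [Nat.testBit_lt_two_pow (lt_of_lt_of_le hx hpow),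
      Nat.testBit_lt_two_pow (lt_of_lt_of_le hy hpow)]

lemma exists_bitSet_eq (S : Finset (Fin n)) : ∃ x < 2 ^ n, bitSet n x = S := by
  refine ⟨Nat.ofBits fun i => decide (i ∈ S), Nat.ofBits_lt_two_pow _, ?_⟩
  ext i
  rw [mem_bitSet, Nat.testBit_ofBits_lt _ _ i.2]
  simp

lemma testBit_two_pow_mul_odd (j r i : ℕ) :
    (2 ^ j * (2 * r + 1)).testBit i = if i = j then true else (2 ^ (j + 1) * r).testBit i := by
  rw [Nat.testBit_two_pow_mul, Nat.testBit_two_pow_mul]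
  rcases lt_trichotomy i j with h | h | h
  · rw [if_neg h.ne, decide_eq_false (by omega), decide_eq_false (by omega)]
    simp
  · subst h
    simp [Nat.testBit_zero]
  · obtain ⟨d, rfl⟩ := Nat.exists_eq_add_of_lt h
    rw [if_neg h.ne', decide_eq_true (by omega), decide_eq_true (by omega),
      show j + d + 1 - j = d + 1 by omega, show j + d + 1 - (j + 1) = d by omega,
      Nat.testBit_succ, show (2 * r + 1) / 2 = r by omega]

lemma lt_of_testBit_two_pow_mul {j r i : ℕ} (h : (2 ^ (j + 1) * r).testBit i) : j < i := by
  rw [Nat.testBit_two_pow_mul, Bool.and_eq_true, decide_eq_true_eq] at h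
  exact h.1

/-- Removing the lowest element from the set coded by `x` leaves a sparse set. -/
def IsAlmostSparse (G : SimpleGraph (Fin n)) (x : ℕ) : Prop :=
  ∀ l, x.testBit l → (∀ i < l, x.testBit i = false) →
    IsSparse G ((bitSet n x).filter fun i => (i : ℕ) ≠ l)

-- Each such set arises from a sparse set by inserting one of n elements; the extra summand covers
-- the empty set, which has no lowest element.
open Classical in
lemma card_isAlmostSparse_le (G : SimpleGraph (Fin n)) :
    ((Finset.range (2 ^ n)).filter fun x => IsAlmostSparse G x).card ≤
      (n + 1) * (Finset.univ.filter fun S : Finset (Fin n) => IsSparse G S).card := by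
  set F := Finset.univ.filter fun S : Finset (Fin n) => IsSparse G S with hF
  have himg : ((Finset.range (2 ^ n)).filter fun x => IsAlmostSparse G x).card =
      (((Finset.range (2 ^ n)).filter fun x => IsAlmostSparse G x).image (bitSet n)).card := by
    refine (Finset.card_image_of_injOn (bitSet_injOn.mono fun x hx => ?_)).symm
    exact Finset.mem_range.1 (Finset.mem_filter.1 (Finset.mem_coe.1 hx)).1
  have hsub : (((Finset.range (2 ^ n)).filter fun x => IsAlmostSparse G x).image (bitSet n)) ⊆
      F ∪ Finset.univ.biUnion fun i => F.image (insert i) := by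
    intro S hS
    obtain ⟨x, hx, rfl⟩ := Finset.mem_image.1 hS
    obtain ⟨hx, hsp⟩ := Finset.mem_filter.1 hx
    rw [Finset.mem_range] at hx
    rcases Nat.eq_zero_or_pos x with rfl | hpos
    · refine Finset.mem_union_left _ (Finset.mem_filter.2 ⟨Finset.mem_univ _, ?_⟩)
      simp [bitSet, IsSparse]
    · have hex : ∃ l, x.testBit l = true := by
        obtain ⟨l, hl⟩ := Nat.exists_testBit_of_ne_zero hpos.ne'
        exact ⟨l, hl⟩
      have hl := Nat.find_spec hex
      have hmin : ∀ i < Nat.find hex, x.testBit i = false := fun i hi => by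
        simpa using Nat.find_min hex hi
      have hln : Nat.find hex < n := by
        by_contra hge
        rw [Nat.testBit_lt_two_pow (lt_of_lt_of_le hx
          (Nat.pow_le_pow_right two_pos (not_lt.1 hge)))] at hl
        exact Bool.false_ne_true hl
      refine Finset.mem_union_right _ (Finset.mem_biUnion.2 ⟨⟨_, hln⟩, Finset.mem_univ _,
        Finset.mem_image.2 ⟨_, Finset.mem_filter.2 ⟨Finset.mem_univ _, hsp _ hl hmin⟩, ?_⟩⟩)
      ext i
      simp only [Finset.mem_insert, Finset.mem_filter, mem_bitSet, Fin.ext_iff]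
      constructor
      · rintro (h | h)
        · rwa [h]
        · exact h.1
      · exact fun h => or_iff_not_imp_left.2 fun h' => ⟨h, h'⟩
  calc _ ≤ (F ∪ Finset.univ.biUnion fun i => F.image (insert i)).card :=
        himg.le.trans (Finset.card_le_card hsub)
    _ ≤ F.card + ∑ i : Fin n, (F.image (insert i)).card :=
        (Finset.card_union_le _ _).trans (Nat.add_le_add_left Finset.card_biUnion_le _)
    _ ≤ F.card + ∑ _i : Fin n, F.card :=
        Nat.add_le_add_left (Finset.sum_le_sum fun _ _ => Finset.card_image_le) _
    _ = (n + 1) * F.card := by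
        rw [Finset.sum_const, Finset.card_univ, Fintype.card_fin, smul_eq_mul]
        ring

open Classical in
/-- The output stream after all sets coded by numbers below `x` have been dealt with. -/
noncomputable def listing (G : SimpleGraph (Fin n)) (x : ℕ) : List ℕ :=
  ((List.range x).filter fun y => IsMinimalCDS G (bitSet n y)).flatMap fun y =>
    charVector (bitSet n y)

open Classical in
lemma listing_succ (G : SimpleGraph (Fin n)) (x : ℕ) :
    listing G (x + 1) = listing G x ++
      if IsMinimalCDS G (bitSet n x) then charVector (bitSet n x) else [] := by
  unfold listing
  rw [List.range_succ, List.filter_append, List.flatMap_append]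
  by_cases h : IsMinimalCDS G (bitSet n x) <;> simp [h]

lemma listing_add_of_forall_not {G : SimpleGraph (Fin n)} {x m : ℕ}
    (h : ∀ d < m, ¬ IsMinimalCDS G (bitSet n (x + d))) : listing G (x + m) = listing G x := by
  classical
  induction m with
  | zero => rfl
  | succ m ih =>
    rw [← Nat.add_assoc, listing_succ, ih fun d hd => h d (by omega), if_neg (h m (by omega)),
      List.append_nil]

lemma listsMinimalCDS_listing (G : SimpleGraph (Fin n)) :
    ListsMinimalCDS G (listing G (2 ^ n)) := by
  classical
  refine ⟨((List.range (2 ^ n)).filter fun y => IsMinimalCDS G (bitSet n y)).map (bitSet n),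
    ?_, fun S => ?_, ?_⟩
  · refine List.Nodup.map_on (fun x hx y hy h => bitSet_injOn ?_ ?_ h)
      (List.nodup_range.filter _)
    · exact List.mem_range.1 (List.mem_filter.1 hx).1
    · exact List.mem_range.1 (List.mem_filter.1 hy).1
  · simp only [List.mem_map, List.mem_filter, List.mem_range, decide_eq_true_eq]
    constructor
    · rintro ⟨x, ⟨-, h⟩, rfl⟩
      exact h
    · intro h
      obtain ⟨x, hx, rfl⟩ := exists_bitSet_eq S
      exact ⟨x, ⟨hx, h⟩, rfl⟩
  · rw [listing, List.flatMap_map]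

end Bits

/-! ### The binary counter on the machine -/

namespace RAM

variable {n M : ℕ} {G G' : SimpleGraph (Fin n)} {s s' : State}

/-- The cells `0, …, n` of an array hold the binary expansion of `x`. -/
def IsBitArray (n : ℕ) (f : ℕ → ℕ) (x : ℕ) : Prop := ∀ i ≤ n, f i = (x.testBit i).toNat

lemma IsBitArray.isCharArray {f : ℕ → ℕ} {x : ℕ} (h : IsBitArray n f x) :
    IsCharArray f (bitSet n x) := by
  intro i
  rw [h i i.2.le]
  cases hx : x.testBit i <;> simp [mem_bitSet, hx]

lemma IsBitArray.ne_zero_iff {f : ℕ → ℕ} {x i : ℕ} (h : IsBitArray n f x) (hi : i ≤ n) :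
    f i ≠ 0 ↔ x.testBit i = true := by
  rw [h i hi]
  cases x.testBit i <;> simp

/-- Add `2 ^ j` to the number in the array `2`, where `j` is the value of the variable `6`. -/
def carry : Prog :=
  .seq (.loop (.arr 2 (.var 6))
    (.seq (.store 2 (.var 6) (.const 0)) (.assign 6 (.add (.var 6) (.const 1)))))
    (.store 2 (.var 6) (.const 1))

/-- The last clause is what the pruning needs: apart from its lowest one, at j ≥ l, the new number
only has ones that x already had, all above j. -/
lemma wp_carry (hM : n + 1 ≤ M) {x l q : ℕ} (hx : x < 2 ^ n) (hxq : x = 2 ^ l * q) (hl : l ≤ n)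
    (hbits : IsBitArray n (s.arr 2) x) (h6 : s.var 6 = l) :
    WP M carry ((n + 1) * 30) (fun s' => Frame [6] [2] s s' ∧
      IsBitArray n (s'.arr 2) (x + 2 ^ l) ∧
      ∃ j, l ≤ j ∧ (x + 2 ^ l).testBit j ∧ ∀ i ≠ j, (x + 2 ^ l).testBit i →
        j < i ∧ x.testBit i) s := by
  refine WP.mono (k := ((n - l) * (14 + 3 + 1) + 3 + 1) + 6 + 1) ?_ (fun _ h => h) (by omega)
  -- When the carry has arrived at position j, the array holds 2^j r and a summand 2^j is still
  -- pending.
  refine WP.seq (k := (n - l) * (14 + 3 + 1) + 3 + 1) (k' := 6) (WP.loop (kb := 14) (fun m s' => Frame [6] [2] s s' ∧ ∃ j r, j + m = n ∧ l ≤ j ∧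
    s'.var 6 = j ∧ x + 2 ^ l = 2 ^ j * (r + 1) ∧ IsBitArray n (s'.arr 2) (2 ^ j * r) ∧
    ∀ i, (2 ^ j * r).testBit i → x.testBit i) ?_ ?_ (n - l) ?_)
  · rintro m s' _ ⟨hF, j, r, hjm, hlj, h6, hsum, hb, hsub⟩ he
    simp only [Expr.eval, h6] at he
    rw [hb.ne_zero_iff (by omega)] at he
    -- Digit n of x is zero, so the carry stops there at the latest.
    have hjn : j < n := by
      by_contra hge
      have := hsub j he
      rw [Nat.testBit_lt_two_pow (lt_of_lt_of_le hx
        (Nat.pow_le_pow_right two_pos (not_lt.1 hge)))] at this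
      exact Bool.false_ne_true this
    obtain ⟨r', rfl⟩ : ∃ r', r = 2 * r' + 1 := by
      rw [Nat.testBit_two_pow_mul, Nat.sub_self, Nat.testBit_zero] at he
      simp only [ge_iff_le, le_refl, decide_true, Bool.true_and, decide_eq_true_eq] at he
      exact ⟨r / 2, by omega⟩
    refine WP.seq (k := 4) (k' := 9) (WP.store (Nat.zero_le _) ?_)
    refine WP.assign (by simp only [Expr.eval, setArr_var, h6]; omega) ?_
    refine ⟨m - 1, by omega, (hF.setArr (by simp) _ _).setVar (by simp) _, j + 1, r', by omega,
      by omega, by simp [Expr.eval, h6], ?_, ?_, ?_⟩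
    · rw [hsum]; ring
    · intro i hi
      simp only [Expr.eval, setVar_arr, setArr_arr, h6, true_and]
      split_ifs with hij
      · subst hij
        rw [Nat.testBit_two_pow_mul, decide_eq_false (by omega)]
        rfl
      · rw [hb i hi, testBit_two_pow_mul_odd, if_neg hij]
    · intro i hi
      refine hsub i ?_
      rw [testBit_two_pow_mul_odd]
      split_ifs
      · rfl
      · exact hi
  · rintro m s' ⟨hF, j, r, hjm, hlj, h6, hsum, hb, hsub⟩ he
    simp only [Expr.eval, h6] at he
    have he : ¬ (2 ^ j * r).testBit j = true := fun h => (hb.ne_zero_iff (by omega)).2 h he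
    obtain ⟨r', rfl⟩ : ∃ r', r = 2 * r' := by
      rw [Nat.testBit_two_pow_mul, Nat.sub_self, Nat.testBit_zero] at he
      simp only [ge_iff_le, le_refl, decide_true, Bool.true_and, decide_eq_true_eq] at he
      exact ⟨r / 2, by omega⟩
    have hpow : 2 ^ j * (2 * r') = 2 ^ (j + 1) * r' := by ring
    rw [hpow] at hb hsub
    refine WP.store (by simp only [Expr.eval]; omega) ⟨hF.setArr (by simp) _ _, ?_, j, hlj, ?_, ?_⟩
    · intro i hi
      rw [hsum, testBit_two_pow_mul_odd]
      simp only [Expr.eval, setArr_arr, h6, true_and]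
      split_ifs with hij
      · rfl
      · exact hb i hi
    · rw [hsum, testBit_two_pow_mul_odd, if_pos rfl]
    · intro i hij hi
      rw [hsum, testBit_two_pow_mul_odd, if_neg hij] at hi
      exact ⟨lt_of_testBit_two_pow_mul hi, hsub i hi⟩
  · exact ⟨Frame.refl _ _ _, l, q, by omega, le_rfl, h6, by rw [hxq]; ring, by rwa [← hxq],
      fun i hi => by rwa [hxq]⟩

/-- Increase the variable `6` to the lowest element of the set in the array `2`. -/
def findLowest : Prog :=
  .loop (.sub (.const 1) (.arr 2 (.var 6))) (.assign 6 (.add (.var 6) (.const 1)))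

lemma wp_findLowest (hM : n ≤ M) {x l : ℕ} (hln : l ≤ n) (hl : x.testBit l)
    (hlow : ∀ i < l, x.testBit i = false) (hbits : IsBitArray n (s.arr 2) x) (h6 : s.var 6 = 0) :
    WP M findLowest ((n + 1) * 30) (fun s' => Frame [6] [] s s' ∧ s'.var 6 = l) s := by
  refine WP.mono (k := l * (9 + 8 + 1) + 8 + 1) ?_ (fun _ h => h) (by omega)
  refine WP.loop (kb := 9) (fun m s' => Frame [6] [] s s' ∧ s'.var 6 + m = l) ?_ ?_ l
    ⟨Frame.refl _ _ _, by omega⟩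
  · rintro m s' _ ⟨hF, hm⟩ he
    have hb : IsBitArray n (s'.arr 2) x := by rw [hF.2.1 2 (by simp)]; exact hbits
    have hne : s'.var 6 ≠ l := by
      rintro h
      simp only [Expr.eval, h, hb l hln, hl] at he
      simp at he
    refine WP.assign (by simp only [Expr.eval]; omega) ⟨m - 1, by omega, hF.setVar (by simp) _, ?_⟩
    simp only [Expr.eval, setVar_var, if_true]
    omega
  · rintro m s' ⟨hF, hm⟩ he
    have hb : IsBitArray n (s'.arr 2) x := by rw [hF.2.1 2 (by simp)]; exact hbits
    refine ⟨hF, ?_⟩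
    by_contra hne
    have hlt : s'.var 6 < l := by omega
    simp only [Expr.eval, hb _ (hlt.le.trans hln), hlow _ hlt] at he
    simp at he

end RAM

/-! ### The enumeration algorithm -/

namespace RAM

variable {n M : ℕ} {G G' : SimpleGraph (Fin n)} {s s' : State}

/-- The memory holds the input graphs, the multiples of `n`, and the number `x` in binary, and the
output stream lists the minimal connected dominating sets coded by numbers below `x`. -/
structure Progress (G G' : SimpleGraph (Fin n)) (x : ℕ) (s : State) : Prop where
  holds : Holds G G' (bitSet n x) s
  bits : IsBitArray n (s.arr 2) x
  out : s.out = listing G x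
  almost : x < 2 ^ n → IsAlmostSparse G' x

/-- Deal with the current set and go on to the next one: the successor if the current set is sparse,
and the next set that does not contain the current one otherwise. -/
def enumerationStep : Prog :=
  .seq testSparse (.seq (.assign 6 (.const 0))
    (.seq (.ite isSparseExpr outputMinimal findLowest) carry))

/-- A bound for the running time of `enumerationStep`, up to the size of the numbers. -/
def enumerationStepCost (n : ℕ) : ℕ :=
  (n * (n * 70 + 120) + 40) +
    (2 + ((31 + (n + 1) * (countReachedCost n + 240) + (n + 1) * 30 + 1) + (n + 1) * 30 + 1) + 1) + 1

lemma enumerationStepCost_le (hn : 0 < n) : enumerationStepCost n ≤ 1400 * n ^ 4 := by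
  have h := countReachedCost_le hn
  have h1 : (n + 1) * (countReachedCost n + 240) ≤ (n + 1) * (226 * n ^ 3 + 240) :=
    Nat.mul_le_mul_left _ (by omega)
  unfold enumerationStepCost
  refine le_trans (b := (n * (n * 70 + 120) + 40) + (2 + ((31 + (n + 1) * (226 * n ^ 3 + 240) +
    (n + 1) * 30 + 1) + (n + 1) * 30 + 1) + 1) + 1) (by omega) ?_
  obtain ⟨m, rfl⟩ := Nat.exists_eq_succ_of_ne_zero hn.ne'
  simp only [Nat.succ_eq_add_one]
  ring_nf
  omega

/-- The code advances by 2^l, with l = 0 for a sparse set and l the lowest element otherwise. In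
both cases the elements above l form a sparse set: by heredity in the first, by almost-sparsity of x
in the second. -/
lemma wp_enumerationStep (hn : 0 < n) (hM : n + 1 ≤ M) (hG : G' ≤ G) {x : ℕ} (hx : x < 2 ^ n)
    (h : Progress G G' x s) :
    WP M enumerationStep (enumerationStepCost n) (fun s' =>
      ∃ y, x < y ∧ y ≤ 2 ^ n ∧ Progress G G' y s') s := by
  classical
  refine WP.seq ((wp_testSparse (by omega) h.holds).imp ?_)
  rintro s₁ ⟨hF₁, hsp⟩
  have hH₁ := h.holds.of_frame hF₁ (by simp) (by simp) (by simp) (by simp) (by simp)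
  have hF₂ : Frame [1, 2, 3, 4, 5, 6] [] s (s₁.setVar 6 0) :=
    ((Frame.refl _ _ _).trans hF₁ (by simp) (by simp)).setVar (by simp) _
  have hH₂ := h.holds.of_frame hF₂ (by simp) (by simp) (by simp) (by simp) (by simp)
  have hsp₂ : isSparseExpr.eval (s₁.setVar 6 0) = isSparseExpr.eval s₁ := by
    simp [isSparseExpr, Expr.eval]
  refine WP.seq (WP.assign (Nat.zero_le _) ?_)
  refine WP.seq (WP.imp (Q := fun s' => s'.var 0 = n ∧ (∀ a < 4, s'.arr a = s.arr a) ∧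
    ∃ l q, x = 2 ^ l * q ∧ l ≤ n ∧ s'.var 6 = l ∧ s'.out = listing G (x + 2 ^ l) ∧
      IsSparse G' ((bitSet n x).filter fun i => l < (i : ℕ))) (WP.ite (fun he => ?_) fun he => ?_) ?_)
  · simp only [Expr.eval] at he
    rw [hsp₂, hsp] at he
    refine (wp_outputMinimal hn (by omega) hH₂).imp ?_
    rintro s₃ ⟨hv, ha, ho⟩
    refine ⟨(hv 0 (by omega)).trans hH₂.var_zero,
      fun a h4 => (ha a h4).trans (hF₂.2.1 a (by simp)), 0, x, by simp, Nat.zero_le _,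
      (hv 6 (by omega)).trans (by simp), ?_, he.anti (Finset.filter_subset _ _)⟩
    rw [ho, hF₂.2.2, h.out, pow_zero, listing_succ]
  · simp only [Expr.eval] at he
    have he' : ¬ IsSparse G' (bitSet n x) := fun hc => hsp.2 hc (hsp₂ ▸ he)
    have hx0 : x ≠ 0 := by
      rintro rfl
      exact he' (by simp [bitSet, IsSparse])
    obtain ⟨l, q, hq, hxl⟩ := Nat.exists_eq_two_pow_mul_odd hx0
    obtain ⟨r, rfl⟩ := hq
    have hbit : x.testBit l = true := by rw [hxl, testBit_two_pow_mul_odd, if_pos rfl]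
    have hlow : ∀ i < l, x.testBit i = false := by
      intro i hi
      rw [hxl, Nat.testBit_two_pow_mul, decide_eq_false (by omega), Bool.false_and]
    have hln : l < n := by
      by_contra hge
      rw [Nat.testBit_lt_two_pow (lt_of_lt_of_le hx
        (Nat.pow_le_pow_right two_pos (not_lt.1 hge)))] at hbit
      exact Bool.false_ne_true hbit
    have hb₂ : IsBitArray n ((s₁.setVar 6 0).arr 2) x := by
      rw [hF₂.2.1 2 (by simp)]; exact h.bits
    refine (wp_findLowest (by omega) hln.le hbit hlow hb₂ (by simp)).imp ?_
    rintro s₃ ⟨hF₃, h6⟩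
    refine ⟨(hF₃.1 0 (by simp)).trans hH₂.var_zero,
      fun a _ => (hF₃.2.1 a (by simp)).trans (hF₂.2.1 a (by simp)), l, 2 * r + 1, hxl, hln.le, h6,
      ?_, ?_⟩
    · rw [hF₃.2.2]
      -- Adding d < 2^l only fills positions below l, so every skipped set contains the current
      -- non-sparse one.
      refine hF₂.2.2.trans (h.out.trans (listing_add_of_forall_not fun d hd hmin => he' ?_).symm)
      refine (hmin.isSparse hG).anti fun i hi => ?_
      rw [mem_bitSet] at hi ⊢
      have hil : l ≤ i := by
        by_contra hlt
        rw [hlow i (by omega)] at hi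
        exact Bool.false_ne_true hi
      rw [hxl] at hi ⊢
      rw [Nat.testBit_two_pow_mul_add _ hd, if_neg (by omega)]
      rw [Nat.testBit_two_pow_mul, decide_eq_true hil, Bool.true_and] at hi
      exact hi
    · refine (h.almost hx l hbit hlow).anti fun i hi => ?_
      rw [Finset.mem_filter] at hi ⊢
      exact ⟨hi.1, hi.2.ne'⟩
  · rintro s₃ ⟨hv0, harr, l, q, hxq, hln, h6, hout, hspl⟩
    have hb₃ : IsBitArray n (s₃.arr 2) x := by rw [harr 2 (by omega)]; exact h.bits
    refine (wp_carry hM hx hxq hln hb₃ h6).imp ?_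
    rintro s₄ ⟨hF₄, hb₄, j, hlj, hj, hji⟩
    refine ⟨x + 2 ^ l, Nat.lt_add_of_pos_right (Nat.two_pow_pos l), ?_, ⟨?_, ?_, ?_, ?_, ?_⟩, hb₄,
      hF₄.2.2.trans hout, fun _ l' hl' hlow' => ?_⟩
    · have hpow : 2 ^ n = 2 ^ l * 2 ^ (n - l) := by rw [← pow_add]; congr 1; omega
      have hq : 2 ^ l * q < 2 ^ l * 2 ^ (n - l) := by rwa [← hxq, ← hpow]
      calc x + 2 ^ l = 2 ^ l * (q + 1) := by rw [hxq, Nat.mul_succ]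
        _ ≤ 2 ^ n := by
          rw [hpow]
          exact Nat.mul_le_mul_left _ (Nat.lt_of_mul_lt_mul_left hq)
    · exact (hF₄.1 0 (by simp)).trans hv0
    · rw [hF₄.2.1 0 (by simp), harr 0 (by omega)]; exact h.holds.arr_zero
    · rw [hF₄.2.1 1 (by simp), harr 1 (by omega)]; exact h.holds.arr_one
    · exact hb₄.isCharArray
    · rw [hF₄.2.1 3 (by simp), harr 3 (by omega)]; exact h.holds.arr_three
    · have hjl : l' = j := by
        rcases lt_trichotomy l' j with hlt | heq | hgt
        · exact absurd (hji l' hlt.ne hl').1 (by omega)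
        · exact heq
        · rw [hlow' j hgt] at hj
          exact absurd hj Bool.false_ne_true
      -- Without its lowest element j ≥ l, the new set retains only elements of the old one above l.
      refine hspl.anti fun i hi => ?_
      rw [Finset.mem_filter, mem_bitSet] at hi ⊢
      obtain ⟨h1, h2⟩ := hji i (hjl ▸ hi.2) hi.1
      exact ⟨h2, by omega⟩

attribute [irreducible] enumerationStepCost

/-- The enumeration algorithm. -/
def enumerateMinimalCDS : Prog :=
  -- Without multiplication, the row offsets of the matrices are tabulated by repeated addition.
  .seq (forN 1 (.store 3 (.add (.var 1) (.const 1)) (.add (.arr 3 (.var 1)) (.var 0))))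
    -- Cell n is the overflow digit, which is set once the code reaches 2^n.
    (.loop (.sub (.const 1) (.arr 2 (.var 0))) enumerationStep)

open Classical in
lemma wp_enumerateMinimalCDS (hn : 0 < n) (hM : n * n + n + 1 ≤ M) (hG : G' ≤ G) :
    WP M enumerateMinimalCDS (n * 34 + 20 +
      (n + 1) * (Finset.univ.filter fun S : Finset (Fin n) => IsSparse G' S).card *
        (enumerationStepCost n + 9)) (fun s' => ListsMinimalCDS G s'.out) (inputState G G') := by
  -- The loop variant: the almost sparse codes from x on. Each visited code is one of them, so the
  -- variant drops at every step.
  set m : ℕ → ℕ := fun x => ((Finset.range (2 ^ n)).filter fun z =>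
    x ≤ z ∧ IsAlmostSparse G' z).card with hm
  have hm0 : m 0 ≤ (n + 1) * (Finset.univ.filter fun S : Finset (Fin n) => IsSparse G' S).card := by
    simpa [hm] using card_isAlmostSparse_le G'
  refine WP.mono (k := (n * (18 + 16) + 9) + (m 0 * (enumerationStepCost n + 8 + 1) + 8 + 1) + 1)
    ?_ (fun _ h => h) ?_
  swap
  · have := Nat.mul_le_mul_right (enumerationStepCost n + 9) hm0
    have h9 : enumerationStepCost n + 8 + 1 = enumerationStepCost n + 9 := by omega
    rw [h9]
    omega
  refine WP.seq (k := n * (18 + 16) + 9) (k' := m 0 * (enumerationStepCost n + 8 + 1) + 8 + 1)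
    (WP.forN (fun k s' => Frame [1] [3] (inputState G G') s' ∧ ∀ j ≤ k, s'.arr 3 j = j * n)
      (by omega) ?_ ?_ ?_ ?_)
  · exact fun k s' hs' => (hs'.1.1 0 (by simp)).trans (by simp [inputState])
  · refine ⟨(Frame.refl _ _ _).setVar (by simp) _, fun j hj => ?_⟩
    obtain rfl : j = 0 := by omega
    simp [inputState]
  · rintro k hk s' _ ⟨hF, h3⟩ h1
    have h0 : s'.var 0 = n := (hF.1 0 (by simp)).trans (by simp [inputState])
    have hval : k * n + n = (k + 1) * n := by ring
    refine WP.store ?_ ⟨by simpa using h1, (hF.setArr (by simp) _ _).setVar (by simp) _, ?_⟩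
    · simp only [Expr.eval, h1, h0, h3 k le_rfl, hval]
      have := Nat.mul_le_mul_right n (Nat.succ_le_of_lt hk)
      simp only [Nat.succ_eq_add_one] at this
      omega
    · intro j hj
      simp only [Expr.eval, setVar_arr, setArr_arr, h1, h0, true_and, h3 k le_rfl, hval]
      split_ifs with hjk
      · rw [hjk]
      · exact h3 j (by omega)
  · rintro s₁ ⟨hF, h3⟩
    have hprog : Progress G G' 0 s₁ := by
      have hb : IsBitArray n (s₁.arr 2) 0 := by
        intro i _
        rw [hF.2.1 2 (by simp)]
        simp [inputState]
      refine ⟨⟨(hF.1 0 (by simp)).trans (by simp [inputState]), ?_, ?_, hb.isCharArray,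
        fun k hk => h3 k hk.le⟩, hb, ?_, fun _ l hl => by simp at hl⟩
      · rw [hF.2.1 0 (by simp)]; simp [inputState]
      · rw [hF.2.1 1 (by simp)]; simp [inputState]
      · rw [hF.2.2]; simp [inputState, listing]
    refine WP.loop (kb := enumerationStepCost n)
      (fun k s' => ∃ x, m x = k ∧ x ≤ 2 ^ n ∧ Progress G G' x s') ?_ ?_ (m 0)
      ⟨0, rfl, Nat.zero_le _, hprog⟩
    · rintro k s' _ ⟨x, rfl, hx, hp⟩ he
      have hlt : x < 2 ^ n := by
        refine lt_of_le_of_ne hx ?_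
        rintro rfl
        simp [Expr.eval, hp.holds.var_zero, hp.bits n le_rfl] at he
      refine (wp_enumerationStep hn (by omega) hG hlt hp).imp ?_
      rintro s'' ⟨y, hxy, hy, hp'⟩
      refine ⟨m y, Finset.card_lt_card ?_, y, rfl, hy, hp'⟩
      refine Finset.ssubset_iff_of_subset (fun z hz => ?_) |>.2 ⟨x, ?_, ?_⟩
      · rw [Finset.mem_filter] at hz ⊢
        exact ⟨hz.1, hxy.le.trans hz.2.1, hz.2.2⟩
      · exact Finset.mem_filter.2 ⟨Finset.mem_range.2 hlt, le_rfl, hp.almost hlt⟩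
      · intro hz
        exact absurd (Finset.mem_filter.1 hz).2.1 (by omega)
    · rintro k s' ⟨x, rfl, hx, hp⟩ he
      have hxn : x = 2 ^ n := by
        by_contra hne
        have hlt : x < 2 ^ n := lt_of_le_of_ne hx hne
        simp [Expr.eval, hp.holds.var_zero, hp.bits n le_rfl, Nat.testBit_lt_two_pow hlt] at he
      rw [hp.out, hxn]
      exact listsMinimalCDS_listing G

open Classical in
theorem exists_exec_enumerateMinimalCDS (hn : 0 < n) (hG : G' ≤ G) :
    ∃ t s, Exec enumerateMinimalCDS (inputState G G') t s ∧ ListsMinimalCDS G s.out ∧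
      t ≤ 12000 * (Finset.univ.filter fun S : Finset (Fin n) => IsSparse G' S).card * n ^ 7 := by
  have hbdd : (inputState G G').Bounded (n * n + n + 1) := by
    refine ⟨fun x => ?_, fun a i => ?_⟩
    · simp only [inputState]
      split_ifs <;> omega
    · have h0 := adjacencyArray_le_one G i
      have h1 := adjacencyArray_le_one G' i
      simp only [inputState]
      split_ifs
      exacts [by omega, by omega, Nat.zero_le _]
  obtain ⟨t, s, hE, ht, -, hL⟩ := wp_enumerateMinimalCDS hn le_rfl hG hbdd
  refine ⟨t, s, hE, hL, ht.trans ?_⟩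
  set F := (Finset.univ.filter fun S : Finset (Fin n) => IsSparse G' S).card with hF
  -- The empty set is sparse, so the cost of the initialisation is absorbed into the main term.
  have hF1 : 1 ≤ F := Finset.card_pos.2
    ⟨∅, Finset.mem_filter.2 ⟨Finset.mem_univ _, by simp [IsSparse]⟩⟩
  have hpow : 1 ≤ n ^ 4 := Nat.one_le_pow _ _ hn
  have h1 : (n + 1) * F * (enumerationStepCost n + 9) ≤ (2 * n) * F * (1409 * n ^ 4) := by
    have := enumerationStepCost_le hn
    gcongr <;> omega
  have h2 : n * 34 + 20 ≤ 54 * (n * (F * n ^ 4)) := by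
    have : n * 1 ≤ n * (F * n ^ 4) := Nat.mul_le_mul_left _ (Nat.mul_pos hF1 hpow)
    omega
  have h3 : n * n + n + 1 + 1 ≤ 4 * n ^ 2 := by nlinarith
  calc _ ≤ (54 * (n * (F * n ^ 4)) + (2 * n) * F * (1409 * n ^ 4)) * (4 * n ^ 2) :=
        Nat.mul_le_mul (Nat.add_le_add h2 h1) h3
    _ = 11488 * F * n ^ 7 := by ring
    _ ≤ 12000 * F * n ^ 7 := by gcongr; norm_num

end RAM

theorem lemma6 :
    (∃ C : ℝ, ∀ (V : Type*) [Fintype V] (G G' : SimpleGraph V) [DecidableRel G'.Adj],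
      IsRobustSpanningSubgraph G G' →
        ({S : Finset V | IsMinimalCDS G S}.ncard : ℝ) ≤
          C * (2 : ℝ) ^ ((Fintype.card V : ℝ) * (1 - 1 / 10 ^ 26))) ∧
    (∃ (P : RAM.Prog) (C : ℝ) (c : ℕ),
      ∀ (n : ℕ) (G G' : SimpleGraph (Fin n)) [DecidableRel G'.Adj],
        IsRobustSpanningSubgraph G G' →
          ∃ (t : ℕ) (s : RAM.State), RAM.Exec P (inputState G G') t s ∧
            ListsMinimalCDS G s.out ∧
            (t : ℝ) ≤ C * (2 : ℝ) ^ ((n : ℝ) * (1 - 1 / 10 ^ 26)) * (n : ℝ) ^ c) := by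
  classical
  refine ⟨⟨1, fun V _ G G' _ h => ?_⟩, RAM.enumerateMinimalCDS, 12000, 7, fun n G G' _ h => ?_⟩
  · have hcount : ({S : Finset V | IsMinimalCDS G S}.ncard : ℝ) ≤
        (Finset.univ.filter fun S : Finset V => IsSparse G' S).card := by
      rw [← Set.ncard_coe_finset]
      refine Nat.cast_le.2 (Set.ncard_le_ncard (fun S hS => ?_) (Set.toFinite _))
      have hS : IsMinimalCDS G S := hS
      simpa using hS.isSparse h.1
    rw [one_mul]
    exact hcount.trans (card_isSparse_le h.2.1 h.2.2)
  -- For n = 0 the strict bound on the number of vertices of small degree would read 0 < 0.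
  · have hn : 0 < n := by
      rcases Nat.eq_zero_or_pos n with rfl | hn
      · have := h.2.2
        simp at this
      · exact hn
    obtain ⟨t, s, hE, hL, ht⟩ := RAM.exists_exec_enumerateMinimalCDS hn h.1
    refine ⟨t, s, hE, hL, ?_⟩
    have hF := card_isSparse_le h.2.1 h.2.2
    rw [Fintype.card_fin] at hF
    calc (t : ℝ) ≤ 12000 * (Finset.univ.filter fun S : Finset (Fin n) => IsSparse G' S).card *
          (n : ℝ) ^ 7 := by exact_mod_cast ht
      _ ≤ _ := by gcongr
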